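/- \textbf{Theorem.} For $k=(k_1,\dots,k_M)\in\mathbb Z_{>0}^M$, $a\in\mathbb R^M$ and a time-dependent Hamiltonian $H$ on $[t_0,t_0+\Delta t]$, the midpoint-based multiproduct formula is $$U_{k}(t_0+\Delta t,t_0)=\sum_{j=1}^M a_j\,U_2^{(k_j)}(t_0+\Delta t,t_0),\qquad U_2^{(m)}(t_0+\Delta t,t_0)=\prod_{q=1}^{m}U_2\!\left(t_0+\tfrac{q\Delta t}{m},\,t_0+\tfrac{(q-1)\Delta t}{m}\right),$$ where later times stand to the left in the product and $U_2(s+\delta,s)=\exp\!\big(-iH(s+\delta/2)\,\delta\big)$. Write $\|a\|_1=\sum_j|a_j|$ and let $\|\cdot\|$ be the spectral norm. One can choose, for every integer $M\ge 1$, vectors $k=k^{(M)}\in\mathbb Z_{>0}^M$ and $a=a^{(M)}\in\mathbb R^M$, depending only on $M$, such that $$\|a^{(M)}\|_1=O(\log M),\qquad \max_j k^{(M)}_j=O(M^2)\qquad(M\to\infty),$$ and such that for every $M\ge1$ the Vandermonde equations $\sum_j a_j=1$ and $\sum_j a_j k_j^{-2l}=0$ $(1\le l\le M-1)$ hold together with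 the following error bound. Let $n\ge 0$ be an integer, $t_0\in\mathbb R$, $\Delta t>0$, $I=[t_0,t_0+\Delta t]$, and let $H:I\to\mathbb C^{2^n\times2^n}$ be Hermitian-valued and $C^\infty$ (one-sided derivatives at the endpoints). Let $\Lambda:I\to[0,\infty)$ satisfy $\Lambda(t)\ge\|H^{(j)}(t)\|^{1/(j+1)}$ for all $t\in I$ and all $j\ge 0$, and suppose that $\Lambda$ attains its maximum on $I$ (for example, $\Lambda$ continuous) and that this maximum is positive. Let $U(t,t_0)$ be the solution on $I$ of $i\,\partial_tU(t,t_0)=H(t)U(t,t_0)$, $U(t_0,t_0)=1$. Then $$\big\|U(t_0+\Delta t,t_0)-U_{k}(t_0+\Delta t,t_0)\big\|<0.32\,\|a\|_1\Big(41\max_{\tau\in I}\Lambda(\tau)\,\Delta t\Big)^{2M+1}.$$ -/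

import Mathlib

open Filter Asymptotics
open scoped ContDiff Matrix.Norms.L2Operator

/-- `Λ` bounds the Hamiltonian on the set `I`: for every `t ∈ I` and every order `j`,
`‖H^{(j)}(t)‖^{1/(j+1)} ≤ Λ t`, in the spectral norm. At the endpoints of an interval the
derivatives are one-sided. -/
def IsLambdaBound {ι : Type*} [Fintype ι] [DecidableEq ι]
    (H : ℝ → Matrix ι ι ℂ) (I : Set ℝ) (Λ : ℝ → ℝ) : Prop :=
  ∀ t ∈ I, ∀ j : ℕ, ‖iteratedDerivWithin j H I t‖ ^ ((1 : ℝ) / ((j : ℝ) + 1)) ≤ Λ t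

/-- `U` is the propagator `t ↦ U(t, t₀)` of `H` on `[t₀, t₁]`: it solves
`i ∂ₜ U = H U`, `U(t₀, t₀) = 1`. -/
def IsPropagator {ι : Type*} [Fintype ι] [DecidableEq ι]
    (H : ℝ → Matrix ι ι ℂ) (t₀ t₁ : ℝ) (U : ℝ → Matrix ι ι ℂ) : Prop :=
  U t₀ = 1 ∧ ∀ t ∈ Set.Icc t₀ t₁,
    HasDerivWithinAt U (-Complex.I • (H t * U t)) (Set.Icc t₀ t₁) t

/-- The midpoint formula `U₂(s + δ, s) = exp(-i H(s + δ/2) δ)`. -/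
noncomputable def midpointFormula {ι : Type*} [Fintype ι] [DecidableEq ι]
    (H : ℝ → Matrix ι ι ℂ) (t s : ℝ) : Matrix ι ι ℂ :=
  NormedSpace.exp ((-Complex.I * ((t - s : ℝ) : ℂ)) • H (s + (t - s) / 2))

/-- The ordered product `f (k - 1) * ⋯ * f 1 * f 0`, in which later factors stand on the left. -/
def orderedProd {A : Type*} [Monoid A] (f : ℕ → A) : ℕ → A
  | 0 => 1
  | k + 1 => f k * orderedProd f k

/-- `U₂^{(k)}(t₀ + Δt, t₀)`: the midpoint formula applied on each of `k` equal steps. The factor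
with index `q = 0, …, k - 1` is `U₂(t₀ + Δt (q + 1) / k, t₀ + Δt q / k)`. -/
noncomputable def midpointSteps {ι : Type*} [Fintype ι] [DecidableEq ι]
    (H : ℝ → Matrix ι ι ℂ) (k : ℕ) (t₀ Δt : ℝ) : Matrix ι ι ℂ :=
  orderedProd (fun q : ℕ =>
    midpointFormula H (t₀ + Δt * ((q : ℝ) + 1) / (k : ℝ)) (t₀ + Δt * (q : ℝ) / (k : ℝ))) k

/-- The midpoint-based multiproduct formula
`U_k(t₀ + Δt, t₀) = ∑ⱼ aⱼ U₂^{(kⱼ)}(t₀ + Δt, t₀)`. -/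
noncomputable def multiproductFormula {ι : Type*} [Fintype ι] [DecidableEq ι] {M : ℕ}
    (H : ℝ → Matrix ι ι ℂ) (k : Fin M → ℕ) (a : Fin M → ℝ) (t₀ Δt : ℝ) : Matrix ι ι ℂ :=
  ∑ j, (a j : ℂ) • midpointSteps H (k j) t₀ Δt

/-- The Vandermonde system of a multiproduct formula of order `2M`:
`∑ⱼ aⱼ = 1` and `∑ⱼ aⱼ kⱼ^{-2l} = 0` for `l = 1, …, M - 1`. -/
def SatisfiesVandermonde {M : ℕ} (k : Fin M → ℕ) (a : Fin M → ℝ) : Prop :=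
  ∀ l : ℕ, l < M → ∑ j, a j * (((k j : ℝ) ^ (2 * l))⁻¹) = if l = 0 then 1 else 0

/-!
At nodes `kⱼ⁻²` proportional to the squares `1, 9, 25, …` the Lagrange weights at `0` decay like
`1 / (2j + 1)`, so their absolute values sum to `O(log M)`; rounding `16 M² / (2j + 1)` to an
integer costs only a constant factor.

The expansion of `N` consecutive midpoint steps in the step size `h` has coefficients that are
polynomials in `N`, of degree at most `j` at order `h ^ j`, and the coefficient of `N ^ j` there is
the Taylor coefficient of the exact propagator. The midpoint rule is time symmetric: `-N` steps of
size `-h` give the same expansion as `N` steps of size `h`, hence with `h = Δt / N` only even powers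
of `1 / N` survive. The Vandermonde equations therefore cancel every error term of order at most
`2M` in `Δt`.

The remainder is estimated coefficientwise: the expansions of the exact propagator and of the
midpoint steps have weighted `ℓ¹` norm at most `2` and `3` at radius `1 / (2Λ)`. This covers
`Λ Δt < 1 / 2`, and for larger `Λ Δt` unitarity of all propagators suffices.
-/

/-! ### Step numbers and weights -/

section OddNodes

open Finset
open scoped Nat

lemma prod_range_abs_odd_sq_sub (j : ℕ) :
    (∏ l ∈ range j, |(2 * l + 1 : ℝ) ^ 2 - (2 * j + 1) ^ 2|) * (2 * j + 1) =
      4 ^ j * ((j + 1 + j)! : ℝ) := by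
  have hfactor : ∀ l ∈ range j, |(2 * l + 1 : ℝ) ^ 2 - (2 * j + 1) ^ 2| =
      4 * ((j - l : ℕ) : ℝ) * ((j + 1 + l : ℕ) : ℝ) := by
    intro l hl
    obtain ⟨i, rfl⟩ := Nat.exists_eq_add_of_le (mem_range.1 hl).le
    have hneg : (2 * l + 1 : ℝ) ^ 2 - (2 * (l + i : ℕ) + 1) ^ 2 ≤ 0 := by
      push_cast
      nlinarith [l.cast_nonneg (α := ℝ), i.cast_nonneg (α := ℝ)]
    rw [Nat.add_sub_cancel_left, abs_of_nonpos hneg]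
    push_cast
    ring
  have hleft : ∏ l ∈ range j, ((j - l : ℕ) : ℝ) = j ! := by
    rw [← Nat.cast_prod, ← Nat.descFactorial_eq_prod_range, Nat.descFactorial_self]
  have hright : (j ! : ℝ) * ∏ l ∈ range j, ((j + 1 + l : ℕ) : ℝ) = (j + j)! := by
    rw [← Nat.cast_prod, ← Nat.ascFactorial_eq_prod_range, ← Nat.cast_mul,
      Nat.factorial_mul_ascFactorial]
  rw [prod_congr rfl hfactor, prod_mul_distrib, prod_mul_distrib, hleft, prod_const, card_range,
    mul_assoc (4 ^ j), hright, add_right_comm, Nat.factorial_succ]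
  push_cast
  ring

lemma prod_erase_abs_odd_sq_sub (j m : ℕ) :
    (∏ l ∈ (range (j + 1 + m)).erase j, |(2 * l + 1 : ℝ) ^ 2 - (2 * j + 1) ^ 2|) * (2 * j + 1) =
      4 ^ (j + m) * (m ! : ℝ) * ((j + 1 + m + j)! : ℝ) := by
  induction m with
  | zero => simp [range_add_one, prod_range_abs_odd_sq_sub]
  | succ m ih =>
    rw [← add_assoc (j + 1), range_add_one, erase_insert_of_ne (by omega),
      prod_insert (by simp), mul_assoc, ih,
      abs_of_nonneg (by push_cast; nlinarith [j.cast_nonneg (α := ℝ), m.cast_nonneg (α := ℝ)]),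
      add_right_comm (j + 1 + m), Nat.factorial_succ, Nat.factorial_succ]
    push_cast
    ring

lemma sub_mul_exp_two_mul_div_le {x y : ℝ} (hx : 0 ≤ x) (hxy : x < y) :
    (y - x) * Real.exp (2 * x / y) ≤ y + x := by
  have hy : 0 < y := hx.trans_lt hxy
  have hd : 0 < y - x := sub_pos.2 hxy
  have hlog := Real.le_log_one_add_of_nonneg (x := 2 * x / (y - x)) (by positivity)
  have hleft : 2 * (2 * x / (y - x)) / (2 * x / (y - x) + 2) = 2 * x / y := by
    field_simp
    ring
  have hright : 1 + 2 * x / (y - x) = (y + x) / (y - x) := by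
    field_simp
    ring
  rwa [hleft, hright, Real.le_log_iff_exp_le (by positivity), le_div_iff₀' hd] at hlog

lemma factorial_mul_factorial_mul_exp_le (j m : ℕ) :
    ((j + m)! : ℝ) * (j + 1 + m)! * Real.exp (j * (j + 1) / (j + 1 + m)) ≤
      m ! * (j + 1 + m + j)! := by
  induction j generalizing m with
  | zero => simp [add_comm 1 m]
  | succ j ih =>
    have hstep := sub_mul_exp_two_mul_div_le (x := (j : ℝ) + 1) (y := j + 1 + (m + 1))
      (by positivity) (by linarith [m.cast_nonneg (α := ℝ)])
    have hexp : Real.exp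
        (((j + 1 : ℕ) : ℝ) * (((j + 1 : ℕ) : ℝ) + 1) / (((j + 1 : ℕ) : ℝ) + 1 + m)) =
        Real.exp (j * (j + 1) / (j + 1 + (m + 1 : ℕ))) *
          Real.exp (2 * (j + 1) / (j + 1 + (m + 1))) := by
      rw [← Real.exp_add]
      congr 1
      push_cast
      field_simp
      ring
    rw [hexp, show j + 1 + m = j + (m + 1) by omega, show j + 1 + 1 + m = j + 1 + (m + 1) by omega]
    calc _ = ((j + (m + 1))! * (j + 1 + (m + 1))! *
            Real.exp (j * (j + 1) / (j + 1 + (m + 1 : ℕ)))) *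
          Real.exp (2 * (j + 1) / (j + 1 + (m + 1))) := by ring
      _ ≤ ((m + 1)! * (j + 1 + (m + 1) + j)!) * Real.exp (2 * (j + 1) / (j + 1 + (m + 1))) :=
        mul_le_mul_of_nonneg_right (ih (m + 1)) (by positivity)
      _ = m ! * (j + 1 + (m + 1) + j)! *
          ((j + 1 + (m + 1) - (j + 1)) * Real.exp (2 * (j + 1) / (j + 1 + (m + 1)))) := by
        rw [Nat.factorial_succ]
        push_cast
        ring
      _ ≤ m ! * (j + 1 + (m + 1) + j)! * (j + 1 + (m + 1) + (j + 1)) := by gcongr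
      _ = m ! * (j + 1 + (m + 1) + (j + 1))! := by
        rw [← add_assoc (j + 1 + (m + 1)), Nat.factorial_succ]
        push_cast
        ring

lemma prod_odd_sq_le (M : ℕ) :
    ∏ l ∈ range (M + 1), (2 * l + 1 : ℝ) ^ 2 ≤ 2 * (4 ^ M * M ! * (M + 1)!) := by
  suffices hsharp : ∏ l ∈ range (M + 1), (2 * l + 1 : ℝ) ^ 2 ≤
      (2 * M + 1) / (M + 1) * (4 ^ M * M ! * (M + 1)!) by
    refine hsharp.trans ?_
    gcongr
    rw [div_le_iff₀ (by positivity)]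
    linarith
  induction M with
  | zero => simp
  | succ M ih =>
    have hratio : (2 * M + 1) / (M + 1) * (2 * (M + 1) + 1) ^ 2 ≤
        (2 * M + 3) * 4 * ((M : ℝ) + 1) := by
      rw [div_mul_eq_mul_div, div_le_iff₀ (by positivity)]
      nlinarith [M.cast_nonneg (α := ℝ)]
    rw [prod_range_succ]
    push_cast
    calc _ ≤ (2 * M + 1) / (M + 1) * (4 ^ M * M ! * (M + 1)!) * (2 * ((M : ℝ) + 1) + 1) ^ 2 := by
          gcongr
      _ = 4 ^ M * M ! * (M + 1)! * ((2 * M + 1) / (M + 1) * (2 * (M + 1) + 1) ^ 2) := by ring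
      _ ≤ 4 ^ M * M ! * (M + 1)! * ((2 * M + 3) * 4 * (M + 1)) := by gcongr
      _ = _ := by
        rw [Nat.factorial_succ (M + 1), Nat.factorial_succ M]
        push_cast
        field_simp
        ring

lemma prod_odd_sq_div_abs_sub_mul_exp_le {M j : ℕ} (hj : j < M) :
    (∏ l ∈ (range M).erase j, (2 * l + 1 : ℝ) ^ 2 / |(2 * l + 1 : ℝ) ^ 2 - (2 * j + 1) ^ 2|) *
      Real.exp (j * (j + 1) / M) ≤ 2 / (2 * j + 1) := by
  obtain ⟨m, rfl⟩ := Nat.exists_eq_add_of_le (Nat.succ_le_of_lt hj)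
  have hnum := prod_odd_sq_le (j + m)
  rw [add_right_comm j m 1, ← mul_prod_erase _ _ (mem_range.2 hj)] at hnum
  have hden := prod_erase_abs_odd_sq_sub j m
  have hfact := factorial_mul_factorial_mul_exp_le j m
  have hden_pos : 0 < ∏ l ∈ (range (j + 1 + m)).erase j,
      |(2 * l + 1 : ℝ) ^ 2 - (2 * j + 1) ^ 2| := by
    refine pos_of_mul_pos_left ?_ (by positivity : (0 : ℝ) ≤ 2 * j + 1)
    rw [hden]
    positivity
  rw [prod_div_distrib, Nat.succ_eq_add_one, div_mul_eq_mul_div,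
    div_le_div_iff₀ hden_pos (by positivity),
    ← mul_le_mul_iff_left₀ (show (0 : ℝ) < 2 * j + 1 by positivity)]
  push_cast
  calc _ = ((2 * j + 1) ^ 2 * ∏ l ∈ (range (j + 1 + m)).erase j, (2 * l + 1 : ℝ) ^ 2) *
        Real.exp (j * (j + 1) / (j + 1 + m)) := by ring
    _ ≤ 2 * (4 ^ (j + m) * (j + m)! * (j + 1 + m)!) * Real.exp (j * (j + 1) / (j + 1 + m)) := by
      gcongr
    _ = 2 * 4 ^ (j + m) *
        ((j + m)! * (j + 1 + m)! * Real.exp (j * (j + 1) / (j + 1 + m))) := by ring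
    _ ≤ 2 * 4 ^ (j + m) * (m ! * (j + 1 + m + j)!) := by gcongr
    _ = _ := by rw [mul_assoc 2 _ (2 * (j : ℝ) + 1), hden]; ring

lemma abs_odd_sq_sub_pos {l j : ℕ} (h : l ≠ j) : 0 < |(2 * l + 1 : ℝ) ^ 2 - (2 * j + 1) ^ 2| := by
  rw [abs_pos, sub_ne_zero, Ne, sq_eq_sq₀ (by positivity) (by positivity)]
  simpa using h

lemma two_le_abs_odd_sub_odd {l j : ℕ} (h : l ≠ j) :
    2 ≤ |(2 * l + 1 : ℝ) - (2 * j + 1)| := by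
  have hint : (1 : ℤ) ≤ |(l : ℤ) - j| := Int.one_le_abs (sub_ne_zero.2 (mod_cast h))
  have hreal : (1 : ℝ) ≤ |(l : ℝ) - j| := mod_cast hint
  rw [add_sub_add_right_eq_sub, ← mul_sub, abs_mul, abs_two]
  linarith

lemma sq_mul_abs_sq_sub_sq_le_exp_mul {L s t x y : ℝ} (hs : 1 ≤ s) (ht : 0 < t)
    (hst : 2 ≤ |t - s|) (hL : 4 * s ^ 2 ≤ L) (hx : x ∈ Set.Icc (L - s) L)
    (hy : y ∈ Set.Icc (L - t) L) (hy0 : 0 ≤ y) :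
    x ^ 2 * |t ^ 2 - s ^ 2| ≤ Real.exp (4 * s ^ 2 / L) * |t ^ 2 * x ^ 2 - s ^ 2 * y ^ 2| := by
  have hL0 : 0 < L := by nlinarith
  have hx0 : 3 / 4 * L ≤ x := by nlinarith [hx.1]
  set u : ℝ := 2 * s ^ 2 / L with hu
  have hu0 : 0 ≤ u := by positivity
  have hu1 : u ≤ 1 / 2 := by
    rw [hu, div_le_iff₀ hL0]
    linarith
  have hrounding : s ^ 2 * |y ^ 2 - x ^ 2| ≤ u * (x ^ 2 * |t ^ 2 - s ^ 2|) :=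
    calc s ^ 2 * |y ^ 2 - x ^ 2| = s ^ 2 * (|y - x| * (y + x)) := by
          rw [sq_sub_sq, abs_mul, abs_of_nonneg (by linarith : 0 ≤ y + x), mul_comm (y + x)]
      _ ≤ s ^ 2 * ((t + s) * (2 * L)) := by
          gcongr
          · linarith
          · exact abs_le.2 ⟨by linarith [hx.2, hy.1], by linarith [hx.1, hy.2]⟩
          · linarith [hx.2, hy.2]
      _ = u * (L ^ 2 * (2 * (t + s)) / 2) := by
          rw [hu]
          field_simp
      _ ≤ u * (2 * x ^ 2 * (|t - s| * (t + s)) / 2) := by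
          gcongr
          nlinarith
      _ = u * (x ^ 2 * |t ^ 2 - s ^ 2|) := by
          rw [sq_sub_sq, abs_mul, abs_of_pos (by linarith : 0 < t + s)]
          ring
  have hexp : 1 ≤ Real.exp (4 * s ^ 2 / L) * (1 - u) := by
    have hlin := Real.add_one_le_exp (4 * s ^ 2 / L)
    rw [show 4 * s ^ 2 / L = 2 * u by rw [hu]; ring] at hlin ⊢
    nlinarith
  calc x ^ 2 * |t ^ 2 - s ^ 2|
      ≤ x ^ 2 * |t ^ 2 - s ^ 2| * (Real.exp (4 * s ^ 2 / L) * (1 - u)) :=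
        le_mul_of_one_le_right (by positivity) hexp
    _ = Real.exp (4 * s ^ 2 / L) *
        (x ^ 2 * |t ^ 2 - s ^ 2| - u * (x ^ 2 * |t ^ 2 - s ^ 2|)) := by ring
    _ ≤ Real.exp (4 * s ^ 2 / L) *
        (|x ^ 2 * (t ^ 2 - s ^ 2)| - |s ^ 2 * (y ^ 2 - x ^ 2)|) := by
      rw [abs_mul, abs_mul, abs_of_nonneg (sq_nonneg x), abs_of_nonneg (sq_nonneg s)]
      gcongr
    _ ≤ Real.exp (4 * s ^ 2 / L) * |x ^ 2 * (t ^ 2 - s ^ 2) - s ^ 2 * (y ^ 2 - x ^ 2)| := by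
      gcongr
      exact abs_sub_abs_le_abs_sub _ _
    _ = Real.exp (4 * s ^ 2 / L) * |t ^ 2 * x ^ 2 - s ^ 2 * y ^ 2| := by
      congr 2
      ring

end OddNodes

section LagrangeAtZero

open Finset

variable {ι K : Type*} [DecidableEq ι] [Field K]

lemma eval_zero_basis_inv {s : Finset ι} {x : ι → K} {j : ι} (hx : ∀ i ∈ s, x i ≠ 0)
    (hj : j ∈ s) :
    (Lagrange.basis s (fun i => (x i)⁻¹) j).eval 0 =
      ∏ l ∈ s.erase j, x j / (x j - x l) := by
  rw [Lagrange.basis, Polynomial.eval_prod]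
  refine prod_congr rfl fun l hl => ?_
  have hl0 := hx l (mem_of_mem_erase hl)
  simp only [Lagrange.basisDivisor, Polynomial.eval_mul, Polynomial.eval_C, Polynomial.eval_sub,
    Polynomial.eval_X, zero_sub]
  rw [inv_sub_inv (hx j hj) hl0, inv_div, ← neg_sub (x j), div_neg, neg_mul_neg,
    div_mul_eq_mul_div, mul_inv_cancel_right₀ hl0]

lemma sum_eval_zero_basis_mul_pow {s : Finset ι} {v : ι → K} (hv : Set.InjOn v s) {l : ℕ}
    (hl : l < #s) :
    ∑ j ∈ s, (Lagrange.basis s v j).eval 0 * v j ^ l = if l = 0 then 1 else 0 := by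
  have h := congrArg (Polynomial.eval 0)
    (Lagrange.eq_interpolate_of_eval_eq (f := (Polynomial.X : Polynomial K) ^ l)
      (fun j => v j ^ l) hv (by simpa using hl) (by simp))
  simp only [Lagrange.interpolate_apply, Polynomial.eval_finsetSum, Polynomial.eval_pow,
    Polynomial.eval_X, Polynomial.eval_mul, Polynomial.eval_C, zero_pow_eq] at h
  simp only [h, mul_comm]

end LagrangeAtZero

section StepWeights

open Finset

/-- The number of steps `⌊16 M² / (2j + 1)⌋` of the `j`-th formula. Up to rounding, the nodes
`kⱼ⁻²` of the Vandermonde system are proportional to the squares of the odd numbers; the factor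
`16` makes the rounding errors cost only a constant factor in the weights. -/
def stepNumber (M : ℕ) (j : Fin M) : ℕ := 16 * M ^ 2 / (2 * j + 1)

/-- The solution of the Vandermonde system with nodes `kⱼ⁻²`: the weights that extrapolate
polynomials of degree less than `M` from these nodes to `0`. -/
noncomputable def stepWeight (M : ℕ) (j : Fin M) : ℝ :=
  (Lagrange.basis univ (fun i : Fin M => ((stepNumber M i : ℝ) ^ 2)⁻¹) j).eval 0

lemma stepNumber_pos (M : ℕ) (j : Fin M) : 0 < stepNumber M j :=
  Nat.div_pos (by nlinarith [j.2]) (by omega)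

lemma stepNumber_mul_odd_mem_Icc (M : ℕ) (j : Fin M) :
    (stepNumber M j : ℝ) * (2 * j + 1) ∈ Set.Icc (16 * M ^ 2 - (2 * j + 1) : ℝ) (16 * M ^ 2) := by
  have hdiv : stepNumber M j * (2 * j + 1) + 16 * M ^ 2 % (2 * (j : ℕ) + 1) = 16 * M ^ 2 :=
    Nat.div_add_mod' _ _
  have hmod : 16 * M ^ 2 % (2 * (j : ℕ) + 1) < 2 * j + 1 := Nat.mod_lt _ (by omega)
  constructor
  · rw [sub_le_iff_le_add]
    exact_mod_cast (by omega : 16 * M ^ 2 ≤ stepNumber M j * (2 * j + 1) + (2 * j + 1))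
  · exact_mod_cast (by omega : stepNumber M j * (2 * j + 1) ≤ 16 * M ^ 2)

lemma stepNumber_sq_mul_le {M : ℕ} {j l : Fin M} (h : l ≠ j) :
    (stepNumber M j : ℝ) ^ 2 * |(2 * l + 1 : ℝ) ^ 2 - (2 * j + 1) ^ 2| ≤
      (2 * l + 1 : ℝ) ^ 2 * Real.exp ((2 * j + 1) ^ 2 / (4 * M ^ 2)) *
        |(stepNumber M j : ℝ) ^ 2 - (stepNumber M l : ℝ) ^ 2| := by
  have hj : (j : ℝ) + 1 ≤ M := by exact_mod_cast j.2
  have hrounding := sq_mul_abs_sq_sub_sq_le_exp_mul (by linarith) (by positivity)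
    (two_le_abs_odd_sub_odd (Fin.val_ne_of_ne h)) (by nlinarith)
    (stepNumber_mul_odd_mem_Icc M j) (stepNumber_mul_odd_mem_Icc M l) (by positivity)
  have harg : 4 * (2 * (j : ℝ) + 1) ^ 2 / (16 * M ^ 2) = (2 * j + 1) ^ 2 / (4 * M ^ 2) := by
    field_simp
    norm_num
  have hfactor : ∀ s t x y : ℝ, t ^ 2 * (x * s) ^ 2 - s ^ 2 * (y * t) ^ 2 =
      s ^ 2 * (t ^ 2 * (x ^ 2 - y ^ 2)) := fun s t x y => by ring
  rw [harg, hfactor, abs_mul, abs_mul, abs_of_nonneg (sq_nonneg (2 * (j : ℝ) + 1)),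
    abs_of_nonneg (sq_nonneg (2 * (l : ℝ) + 1))] at hrounding
  refine le_of_mul_le_mul_left ?_ (by positivity : (0 : ℝ) < (2 * j + 1) ^ 2)
  linarith

lemma stepNumber_sq_injective (M : ℕ) :
    Function.Injective fun i : Fin M => (stepNumber M i : ℝ) ^ 2 := by
  intro l j hlj
  by_contra h
  have hle := stepNumber_sq_mul_le h
  rw [sub_eq_zero.2 hlj.symm, abs_zero, mul_zero] at hle
  have hpos : (0 : ℝ) < (stepNumber M j : ℝ) ^ 2 := by
    have := stepNumber_pos M j
    positivity
  exact hle.not_gt (mul_pos hpos (abs_odd_sq_sub_pos (Fin.val_ne_of_ne h)))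

theorem satisfiesVandermonde_stepWeight (M : ℕ) :
    SatisfiesVandermonde (stepNumber M) (stepWeight M) := by
  intro l hl
  simp only [pow_mul, ← inv_pow _ l]
  exact sum_eval_zero_basis_mul_pow (inv_injective.comp (stepNumber_sq_injective M)).injOn
    (by simpa using hl)

lemma prod_univ_erase_eq_prod_range_erase {N : Type*} [CommMonoid N] {M : ℕ} (f : ℕ → N)
    (j : Fin M) : ∏ l ∈ univ.erase j, f l = ∏ l ∈ (range M).erase j, f l := by
  have hmap : (univ.erase j).map Fin.valEmbedding = (range M).erase j := by
    rw [map_erase, Fin.map_valEmbedding_univ, Nat.Iio_eq_range, Fin.valEmbedding_apply]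
  rw [← hmap, prod_map]
  rfl

lemma abs_stepWeight_le_prod (M : ℕ) (j : Fin M) :
    |stepWeight M j| ≤
      (∏ l ∈ (range M).erase j, (2 * l + 1 : ℝ) ^ 2 / |(2 * l + 1 : ℝ) ^ 2 - (2 * j + 1) ^ 2|) *
        Real.exp ((2 * j + 1) ^ 2 / (4 * M ^ 2)) ^ (M - 1) := by
  have hne : ∀ i ∈ univ, (stepNumber M i : ℝ) ^ 2 ≠ 0 := fun i _ =>
    pow_ne_zero 2 (Nat.cast_ne_zero.2 (stepNumber_pos M i).ne')
  have hcard : #(univ.erase j) = M - 1 := by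
    rw [card_erase_of_mem (mem_univ j), card_fin]
  rw [stepWeight, eval_zero_basis_inv hne (mem_univ j), abs_prod,
    ← prod_univ_erase_eq_prod_range_erase
      (fun l : ℕ => (2 * l + 1 : ℝ) ^ 2 / |(2 * l + 1 : ℝ) ^ 2 - (2 * j + 1) ^ 2|),
    ← hcard, ← prod_const, ← prod_mul_distrib]
  refine prod_le_prod (fun l _ => abs_nonneg _) fun l hl => ?_
  have hlj := ne_of_mem_erase hl
  have hk : (stepNumber M j : ℝ) ^ 2 - (stepNumber M l : ℝ) ^ 2 ≠ 0 :=
    sub_ne_zero.2 ((stepNumber_sq_injective M).ne hlj.symm)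
  rw [abs_div, abs_of_nonneg (sq_nonneg (stepNumber M j : ℝ)), div_mul_eq_mul_div,
    div_le_div_iff₀ (abs_pos.2 hk) (abs_odd_sq_sub_pos (Fin.val_ne_of_ne hlj))]
  exact stepNumber_sq_mul_le hlj

lemma abs_stepWeight_le (M : ℕ) (j : Fin M) : |stepWeight M j| ≤ 3 / (2 * j + 1) := by
  have hM : (1 : ℝ) ≤ M := Nat.one_le_cast.2 j.pos
  have hexp : Real.exp ((2 * j + 1) ^ 2 / (4 * M ^ 2)) ^ (M - 1) ≤
      4 / 3 * Real.exp (j * (j + 1) / M) :=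
    calc Real.exp ((2 * j + 1) ^ 2 / (4 * M ^ 2)) ^ (M - 1)
        ≤ Real.exp ((2 * j + 1) ^ 2 / (4 * M ^ 2)) ^ M :=
          pow_le_pow_right₀ (Real.one_le_exp (by positivity)) (Nat.sub_le M 1)
      _ = Real.exp (1 / 4 / M) * Real.exp (j * (j + 1) / M) := by
          rw [← Real.exp_nat_mul, ← Real.exp_add]
          congr 1
          field_simp
          ring
      _ ≤ Real.exp (1 / 4) * Real.exp (j * (j + 1) / M) :=
          mul_le_mul_of_nonneg_right
            (Real.exp_le_exp.2 (div_le_self (by norm_num) hM)) (Real.exp_nonneg _)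
      _ ≤ 4 / 3 * Real.exp (j * (j + 1) / M) := by
          gcongr
          have := Real.exp_bound_div_one_sub_of_interval (x := 1 / 4) (by norm_num) (by norm_num)
          norm_num at this ⊢
          exact this
  calc |stepWeight M j|
      ≤ (∏ l ∈ (range M).erase j,
          (2 * l + 1 : ℝ) ^ 2 / |(2 * l + 1 : ℝ) ^ 2 - (2 * j + 1) ^ 2|) *
            (4 / 3 * Real.exp (j * (j + 1) / M)) :=
        (abs_stepWeight_le_prod M j).trans (by gcongr)
    _ = 4 / 3 * ((∏ l ∈ (range M).erase j,
          (2 * l + 1 : ℝ) ^ 2 / |(2 * l + 1 : ℝ) ^ 2 - (2 * j + 1) ^ 2|) *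
            Real.exp (j * (j + 1) / M)) := by ring
    _ ≤ 4 / 3 * (2 / (2 * j + 1)) := by
        gcongr
        exact prod_odd_sq_div_abs_sub_mul_exp_le j.2
    _ ≤ 3 / (2 * j + 1) := by
        rw [← mul_div_assoc]
        gcongr
        norm_num

lemma sum_abs_stepWeight_le (M : ℕ) : ∑ j, |stepWeight M j| ≤ 3 * (1 + Real.log M) :=
  calc ∑ j, |stepWeight M j| ≤ ∑ j : Fin M, 3 * ((j : ℝ) + 1)⁻¹ := by
        refine sum_le_sum fun j _ => (abs_stepWeight_le M j).trans ?_
        rw [← div_eq_mul_inv]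
        gcongr
        linarith [(j : ℕ).cast_nonneg (α := ℝ)]
    _ = 3 * (harmonic M : ℚ) := by
        rw [← mul_sum, Fin.sum_univ_eq_sum_range (fun j : ℕ => ((j : ℝ) + 1)⁻¹), harmonic]
        push_cast
        rfl
    _ ≤ 3 * (1 + Real.log M) := by
        gcongr
        exact harmonic_le_one_add_log M

theorem sum_abs_stepWeight_isBigO :
    (fun M : ℕ => ∑ j, |stepWeight M j|) =O[atTop] fun M : ℕ => Real.log (M : ℝ) := by
  refine IsBigO.of_bound 6 ?_
  filter_upwards [eventually_ge_atTop 3] with M hM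
  have hlog : 1 ≤ Real.log M := by
    rw [Real.le_log_iff_exp_le (by positivity)]
    exact Real.exp_one_lt_three.le.trans (mod_cast hM)
  rw [Real.norm_of_nonneg (by positivity), Real.norm_of_nonneg (by positivity)]
  linarith [sum_abs_stepWeight_le M]

theorem sup_stepNumber_isBigO :
    (fun M : ℕ => ((univ.sup (stepNumber M) : ℕ) : ℝ)) =O[atTop] fun M : ℕ => (M : ℝ) ^ 2 := by
  refine IsBigO.of_bound 16 (Eventually.of_forall fun M => ?_)
  rw [Real.norm_of_nonneg (by positivity), Real.norm_of_nonneg (by positivity)]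
  exact_mod_cast Finset.sup_le fun j _ => Nat.div_le_self _ _

end StepWeights

/-! ### Summation of polynomials -/

section ScalarEval

open Finset Polynomial

variable {K R : Type*} [CommSemiring K] [Semiring R] [Algebra K R]

/-- Evaluation of a polynomial with coefficients in a (not necessarily commutative) `K`-algebra at
a scalar of `K`. Scalars are central, so this is a ring homomorphism. -/
noncomputable def scalarEval (x : K) : R[X] →+* R :=
  eval₂RingHom' (RingHom.id R) (algebraMap K R x) fun r => (Algebra.commutes x r).symm

lemma scalarEval_apply (x : K) (P : R[X]) : scalarEval x P = P.eval (algebraMap K R x) :=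
  rfl

@[simp]
lemma scalarEval_C (x : K) (r : R) : scalarEval x (C r) = r := by
  rw [scalarEval_apply, eval_C]

@[simp]
lemma scalarEval_X (x : K) : scalarEval x (X : R[X]) = algebraMap K R x := by
  rw [scalarEval_apply, eval_X]

@[simp]
lemma scalarEval_map (x : K) (p : K[X]) :
    scalarEval x (p.map (algebraMap K R)) = algebraMap K R (p.eval x) := by
  rw [scalarEval_apply, eval_map, eval₂_at_apply]

lemma scalarEval_eq_sum_range (x : K) {P : R[X]} {n : ℕ} (h : P.natDegree < n) :
    scalarEval x P = ∑ i ∈ range n, x ^ i • P.coeff i := by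
  rw [scalarEval_apply, eval_eq_sum_range' h]
  refine sum_congr rfl fun i _ => ?_
  rw [← map_pow, ← Algebra.commutes, ← Algebra.smul_def]

lemma scalarEval_zero (P : R[X]) : scalarEval (0 : K) P = P.coeff 0 := by
  rw [scalarEval_apply, map_zero, coeff_zero_eq_eval_zero]

end ScalarEval

section Antidifference

open Finset Polynomial

variable {K R : Type*} [Field K] [CharZero K] [Ring R] [Algebra K R]

variable (K) in
/-- Faulhaber's polynomial `(Bₙ₊₁(X) - Bₙ₊₁(0)) / (n + 1)`, whose value at a natural number `m` is
`0 ^ n + 1 ^ n + ⋯ + (m - 1) ^ n`. -/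
noncomputable def powSum (n : ℕ) : K[X] :=
  (C ((n + 1 : ℚ)⁻¹) * (Polynomial.bernoulli (n + 1) - C (_root_.bernoulli (n + 1)))).map
    (algebraMap ℚ K)

lemma powSum_comp_X_add_one (n : ℕ) : (powSum K n).comp (X + 1) = powSum K n + X ^ n := by
  have hn : (n + 1 : ℚ) ≠ 0 := by positivity
  have hrat :
      (C ((n + 1 : ℚ)⁻¹) * (Polynomial.bernoulli (n + 1) - C (_root_.bernoulli (n + 1)))).comp
          (X + 1) =
        C ((n + 1 : ℚ)⁻¹) * (Polynomial.bernoulli (n + 1) - C (_root_.bernoulli (n + 1))) +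
          X ^ n := by
    refine Polynomial.funext fun x => ?_
    simp only [eval_comp, eval_add, eval_mul, eval_sub, eval_pow, eval_C, eval_X, eval_one]
    rw [add_comm x 1, bernoulli_eval_one_add]
    push_cast
    field_simp
    ring
  simpa [powSum, Polynomial.map_comp] using congrArg (Polynomial.map (algebraMap ℚ K)) hrat

lemma eval_add_one_powSum (n : ℕ) (x : K) :
    (powSum K n).eval (x + 1) = (powSum K n).eval x + x ^ n := by
  simpa using congrArg (eval x) (powSum_comp_X_add_one (K := K) n)

lemma eval_zero_powSum (n : ℕ) : (powSum K n).eval 0 = 0 := by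
  simp [powSum, eval_map, eval₂_at_zero, coeff_bernoulli]

lemma natDegree_powSum_le (n : ℕ) : (powSum K n).natDegree ≤ n + 1 := by
  refine natDegree_map_le.trans ((natDegree_C_mul_le _ _).trans (natDegree_sub_C.trans_le ?_))
  rw [natDegree_le_iff_coeff_eq_zero]
  intro N hN
  rw [coeff_bernoulli, if_neg (by omega)]

lemma coeff_powSum (n : ℕ) : (powSum K n).coeff (n + 1) = (n + 1 : K)⁻¹ := by
  simp [powSum, coeff_bernoulli]

variable (K) in
/-- The antidifference of a polynomial `P` that vanishes at `0`: the polynomial whose value at a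
natural number `m` is `P(0) + P(1) + ⋯ + P(m - 1)`. -/
noncomputable def antidiff (P : R[X]) : R[X] :=
  ∑ i ∈ range (P.natDegree + 1), C (P.coeff i) * (powSum K i).map (algebraMap K R)

lemma scalarEval_add_one_antidiff (P : R[X]) (x : K) :
    scalarEval (x + 1) (antidiff K P) = scalarEval x (antidiff K P) + scalarEval x P := by
  rw [scalarEval_eq_sum_range x (Nat.lt_succ_self P.natDegree), antidiff, map_sum, map_sum,
    ← sum_add_distrib]
  refine sum_congr rfl fun i _ => ?_
  simp only [map_mul, scalarEval_C, scalarEval_map, eval_add_one_powSum, map_add, mul_add]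
  rw [← Algebra.commutes, ← Algebra.smul_def, ← Algebra.commutes (x ^ i), ← Algebra.smul_def]

lemma coeff_zero_antidiff (P : R[X]) : (antidiff K P).coeff 0 = 0 := by
  rw [← scalarEval_zero (K := K), antidiff, map_sum]
  exact sum_eq_zero fun i _ => by simp [eval_zero_powSum]

lemma natDegree_antidiff_le {P : R[X]} {n : ℕ} (h : P.natDegree ≤ n) :
    (antidiff K P).natDegree ≤ n + 1 := by
  refine natDegree_sum_le_of_forall_le _ _ fun i hi => (natDegree_C_mul_le _ _).trans ?_
  refine natDegree_map_le.trans ((natDegree_powSum_le i).trans ?_)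
  have := mem_range.1 hi
  omega

lemma coeff_antidiff {P : R[X]} {n : ℕ} (h : P.natDegree ≤ n) :
    (antidiff K P).coeff (n + 1) = (n + 1 : K)⁻¹ • P.coeff n := by
  have hextend : antidiff K P =
      ∑ i ∈ range (n + 1), C (P.coeff i) * (powSum K i).map (algebraMap K R) := by
    refine sum_subset (range_subset_range.2 (by omega)) fun i _ hi => ?_
    rw [coeff_eq_zero_of_natDegree_lt (by simpa using hi), C_0, zero_mul]
  have hlower : ∀ i ∈ range n,
      (C (P.coeff i) * (powSum K i).map (algebraMap K R)).coeff (n + 1) = 0 := by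
    intro i hi
    have hdeg := natDegree_powSum_le (K := K) i
    have hin := mem_range.1 hi
    rw [coeff_C_mul, coeff_map, coeff_eq_zero_of_natDegree_lt (p := powSum K i) (by omega),
      map_zero, mul_zero]
  rw [hextend, finsetSum_coeff, sum_range_succ, sum_eq_zero hlower, zero_add, coeff_C_mul,
    coeff_map, coeff_powSum, ← Algebra.commutes, ← Algebra.smul_def]

end Antidifference

/-! ### Substitution in power series -/

section Dilate

open Finset PowerSeries

variable {K R : Type*} [CommSemiring K] [Semiring R] [Algebra K R]

/-- The substitution `X ↦ c X` in a power series over a `K`-algebra, for a scalar `c`. For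
commutative coefficients this is `PowerSeries.rescale`. -/
noncomputable def dilate (c : K) : R⟦X⟧ →+* R⟦X⟧ where
  toFun p := mk fun n => c ^ n • coeff n p
  map_zero' := by ext; simp
  map_one' := by
    ext n
    rcases eq_or_ne n 0 with rfl | hn
    · simp
    · simp [coeff_one, hn]
  map_add' p q := by ext; simp
  map_mul' p q := by
    ext n
    rw [coeff_mk, coeff_mul, coeff_mul, smul_sum]
    refine sum_congr rfl fun ij hij => ?_
    rw [coeff_mk, coeff_mk, smul_mul_smul_comm, ← pow_add, mem_antidiagonal.1 hij]

@[simp]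
lemma coeff_dilate (c : K) (p : R⟦X⟧) (n : ℕ) : coeff n (dilate c p) = c ^ n • coeff n p := by
  simp [dilate]

lemma dilate_dilate (c d : K) (p : R⟦X⟧) : dilate c (dilate d p) = dilate (c * d) p := by
  ext n
  simp only [coeff_dilate, smul_smul, mul_pow]

lemma dilate_X (c : K) : dilate c (X : R⟦X⟧) = c • X := by
  ext n
  rcases eq_or_ne n 1 with rfl | hn
  · simp
  · simp [coeff_X, hn]

end Dilate

section SubstXMul

open Finset PowerSeries

variable {K R : Type*} [CommRing K] [Ring R] [Algebra K R]

lemma coeff_X_mul_pow (p : R⟦X⟧) (r j : ℕ) :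
    coeff j ((X * p) ^ r) = if r ≤ j then coeff (j - r) (p ^ r) else 0 := by
  rw [(commute_X p).symm.mul_pow, coeff_X_pow_mul']

/-- The substitution of `X p` into the power series `f` with scalar coefficients. Mathlib's
`PowerSeries.subst` requires commutative coefficients. The powers `(X p) ^ r` with `r > j` do not
contribute to the `j`-th coefficient, so every coefficient is a finite sum. -/
noncomputable def substXMul (f : K⟦X⟧) (p : R⟦X⟧) : R⟦X⟧ :=
  mk fun j => ∑ r ∈ range (j + 1), coeff r f • coeff j ((X * p) ^ r)

lemma coeff_substXMul_eq_sum_range (f : K⟦X⟧) (p : R⟦X⟧) {j n : ℕ} (h : j < n) :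
    coeff j (substXMul f p) = ∑ r ∈ range n, coeff r f • coeff j ((X * p) ^ r) := by
  rw [substXMul, coeff_mk]
  refine sum_subset (range_subset_range.2 h) fun r _ hr => ?_
  rw [coeff_X_mul_pow, if_neg (by simpa using hr), smul_zero]

lemma coeff_substXMul_congr {f g : K⟦X⟧} (p : R⟦X⟧) {j : ℕ}
    (h : ∀ r ≤ j, coeff r f = coeff r g) :
    coeff j (substXMul f p) = coeff j (substXMul g p) := by
  rw [substXMul, substXMul, coeff_mk, coeff_mk]
  exact sum_congr rfl fun r hr => by rw [h r (mem_range_succ_iff.1 hr)]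

lemma substXMul_coe (q : Polynomial K) (p : R⟦X⟧) :
    substXMul (q : K⟦X⟧) p = Polynomial.aeval (X * p) q := by
  ext j
  have hdeg : q.natDegree < max (j + 1) (q.natDegree + 1) := by omega
  rw [coeff_substXMul_eq_sum_range _ p (by omega : j < max (j + 1) (q.natDegree + 1)),
    Polynomial.aeval_eq_sum_range' hdeg, map_sum]
  simp only [Polynomial.coeff_coe, coeff_smul]

lemma substXMul_one (p : R⟦X⟧) : substXMul (1 : K⟦X⟧) p = 1 := by
  rw [← Polynomial.coe_one, substXMul_coe, map_one]

lemma substXMul_mul (f g : K⟦X⟧) (p : R⟦X⟧) :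
    substXMul (f * g) p = substXMul f p * substXMul g p := by
  ext j
  have htrunc : ∀ (f : K⟦X⟧) {i : ℕ}, i ≤ j →
      coeff i (substXMul f p) = coeff i (substXMul (f.trunc (j + 1) : K⟦X⟧) p) := fun f i hi =>
    coeff_substXMul_congr p fun r hr => (coeff_coe_trunc_of_lt (by omega)).symm
  calc coeff j (substXMul (f * g) p)
      = coeff j (substXMul (f.trunc (j + 1) * g.trunc (j + 1) : K⟦X⟧) p) :=
        coeff_substXMul_congr p fun r hr =>
          coeff_mul_eq_coeff_trunc_mul_trunc f g (by omega)
    _ = coeff j (substXMul (f.trunc (j + 1) : K⟦X⟧) p *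
          substXMul (g.trunc (j + 1) : K⟦X⟧) p) := by
        rw [← Polynomial.coe_mul, substXMul_coe, map_mul, substXMul_coe, substXMul_coe]
    _ = coeff j (substXMul f p * substXMul g p) := by
        rw [coeff_mul, coeff_mul]
        refine sum_congr rfl fun ij hij => ?_
        have hj := mem_antidiagonal.1 hij
        rw [← htrunc f (by omega), ← htrunc g (by omega)]

lemma substXMul_neg (f : K⟦X⟧) (p : R⟦X⟧) : substXMul f (-p) = substXMul (evalNegHom f) p := by
  ext j
  rw [substXMul, substXMul, coeff_mk, coeff_mk]
  refine sum_congr rfl fun r _ => ?_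
  rw [mul_neg, evalNegHom, coeff_rescale, ← neg_one_smul K (X * p), smul_pow, coeff_smul, smul_smul,
    mul_comm]

lemma dilate_substXMul (c : K) (f : K⟦X⟧) (p : R⟦X⟧) :
    dilate c (substXMul f p) = substXMul f (c • dilate c p) := by
  ext j
  rw [coeff_dilate, substXMul, substXMul, coeff_mk, coeff_mk, smul_sum]
  refine sum_congr rfl fun r _ => ?_
  rw [smul_comm, ← coeff_dilate, map_pow, map_mul, dilate_X, smul_mul_assoc, mul_smul_comm]

lemma substXMul_exp_neg_mul_self [Algebra ℚ K] (p : R⟦X⟧) :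
    substXMul (exp K) (-p) * substXMul (exp K) p = 1 := by
  rw [substXMul_neg, ← substXMul_mul, mul_comm, exp_mul_exp_neg_eq_one, substXMul_one]

end SubstXMul

/-! ### The step-size expansion of the midpoint rule -/

section FormalMidpoint

open Finset Polynomial PowerSeries

variable {K R : Type*} [Field K] [CharZero K] [Ring R] [Algebra K R]

/-- The expansion in the step size `h` of the midpoint step `exp (h A(y h))`, where
`A(s) = ∑ Bₚ s ^ p` and `y` is the position of the midpoint in units of `h`. -/
noncomputable def midStepSeries (B : ℕ → R) (y : K) : R⟦X⟧ :=
  substXMul (PowerSeries.exp K) (dilate y (PowerSeries.mk B))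

lemma midStepSeries_mul_dilate_neg_one (B : ℕ → R) (y : K) :
    midStepSeries B y * dilate (-1 : K) (midStepSeries B (-y)) = 1 := by
  have h := substXMul_exp_neg_mul_self (K := K) (-dilate y (PowerSeries.mk B))
  rwa [neg_neg, ← neg_one_smul K (dilate y _), ← neg_neg y, ← neg_one_mul (-y), ← dilate_dilate,
    ← dilate_substXMul, dilate_dilate, neg_one_mul, neg_neg] at h

lemma coeff_zero_midStepSeries (B : ℕ → R) (y : K) :
    PowerSeries.coeff 0 (midStepSeries B y) = 1 := by
  simp [midStepSeries, substXMul]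

variable (K) in
/-- The coefficient of order `j + 1` in the expansion of the midpoint step from `x` to `x + 1`, in
units of the step size, as a polynomial in `x`. -/
noncomputable def midStepPoly (B : ℕ → R) (j : ℕ) : R[X] :=
  ∑ r ∈ range (j + 1),
    Polynomial.C (PowerSeries.coeff (r + 1) (PowerSeries.exp K) •
        PowerSeries.coeff (j - r) (PowerSeries.mk B ^ (r + 1))) *
      (Polynomial.X + Polynomial.C (algebraMap K R (1 / 2))) ^ (j - r)

lemma coeff_succ_midStepSeries (B : ℕ → R) (x : K) (j : ℕ) :
    PowerSeries.coeff (j + 1) (midStepSeries B (x + 1 / 2)) = scalarEval x (midStepPoly K B j) := by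
  rw [midStepSeries, substXMul, PowerSeries.coeff_mk, sum_range_succ', midStepPoly, map_sum,
    pow_zero, PowerSeries.coeff_one, if_neg (Nat.succ_ne_zero j), smul_zero, add_zero]
  refine sum_congr rfl fun r hr => ?_
  have hpow : scalarEval x ((Polynomial.X + Polynomial.C (algebraMap K R (1 / 2))) ^ (j - r)) =
      algebraMap K R ((x + 1 / 2) ^ (j - r)) := by
    simp only [map_pow, map_add, scalarEval_X, scalarEval_C]
  rw [coeff_X_mul_pow, if_pos (by have := mem_range.1 hr; omega), Nat.add_sub_add_right,
    ← map_pow (dilate _), coeff_dilate, map_mul (scalarEval x), hpow, scalarEval_C,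
    ← Algebra.commutes, ← Algebra.smul_def, smul_comm]

lemma natDegree_X_add_C_pow_le (c : R) (n : ℕ) :
    ((Polynomial.X + Polynomial.C c) ^ n).natDegree ≤ n :=
  (natDegree_pow_le_of_le n (natDegree_add_C.trans_le natDegree_X_le)).trans (mul_one n).le

lemma natDegree_midStepPoly_le (B : ℕ → R) (j : ℕ) : (midStepPoly K B j).natDegree ≤ j :=
  natDegree_sum_le_of_forall_le _ _ fun _ _ =>
    (natDegree_C_mul_le _ _).trans ((natDegree_X_add_C_pow_le _ _).trans (Nat.sub_le _ _))

lemma coeff_midStepPoly (B : ℕ → R) (j : ℕ) : (midStepPoly K B j).coeff j = B j := by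
  have hlower : ∀ r ∈ range j, (Polynomial.C (PowerSeries.coeff (r + 1 + 1) (PowerSeries.exp K) •
      PowerSeries.coeff (j - (r + 1)) (PowerSeries.mk B ^ (r + 1 + 1))) *
      (Polynomial.X + Polynomial.C (algebraMap K R (1 / 2))) ^ (j - (r + 1))).coeff j = 0 := by
    intro r hr
    have := mem_range.1 hr
    rw [Polynomial.coeff_C_mul, coeff_eq_zero_of_natDegree_lt, mul_zero]
    exact (natDegree_X_add_C_pow_le _ _).trans_lt (by omega)
  rw [midStepPoly, finsetSum_coeff, sum_range_succ', sum_eq_zero hlower, zero_add,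
    Polynomial.coeff_C_mul, Polynomial.coeff_X_add_C_pow]
  simp [PowerSeries.coeff_exp]

variable (K) in
/-- The coefficient of order `j` in the expansion of `N` consecutive midpoint steps, as a polynomial
in `N`. -/
noncomputable def stepsPoly (B : ℕ → R) : ℕ → R[X]
  | 0 => 1
  | j + 1 => antidiff K (∑ i : Fin (j + 1), midStepPoly K B (j - i) * stepsPoly B i)

variable (K) in
/-- The Taylor coefficients of the solution of `U' = A U`, `U(0) = 1`, where
`A(s) = ∑ Bₚ s ^ p`. -/
noncomputable def propagatorCoeff (B : ℕ → R) : ℕ → R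
  | 0 => 1
  | j + 1 => (j + 1 : K)⁻¹ • ∑ i : Fin (j + 1), B (j - i) * propagatorCoeff B i

lemma sum_fin_eq_sum_antidiagonal {E : Type*} [AddCommMonoid E] (f : ℕ → ℕ → E) (n : ℕ) :
    ∑ i : Fin (n + 1), f (n - i) i = ∑ p ∈ antidiagonal n, f p.1 p.2 := by
  rw [Fin.sum_univ_eq_sum_range (fun i => f (n - i) i),
    ← Nat.sum_antidiagonal_eq_sum_range_succ (fun i k => f k i), ← Nat.sum_antidiagonal_swap]
  rfl

/-- The formal derivative. Mathlib's `PowerSeries.derivative` requires commutative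
coefficients. -/
noncomputable def formalDeriv {R : Type*} [Semiring R] (p : R⟦X⟧) : R⟦X⟧ :=
  PowerSeries.mk fun n => (n + 1) • PowerSeries.coeff (n + 1) p

lemma formalDeriv_mk_propagatorCoeff (B : ℕ → R) :
    formalDeriv (PowerSeries.mk (propagatorCoeff K B)) =
      PowerSeries.mk B * PowerSeries.mk (propagatorCoeff K B) := by
  ext n
  have hn : ((n + 1 : ℕ) : K) ≠ 0 := Nat.cast_ne_zero.2 n.succ_ne_zero
  rw [formalDeriv, PowerSeries.coeff_mk, PowerSeries.coeff_mk, propagatorCoeff, ← Nat.cast_succ,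
    ← Nat.cast_smul_eq_nsmul K, smul_inv_smul₀ hn,
    sum_fin_eq_sum_antidiagonal fun a b => B a * propagatorCoeff K B b, PowerSeries.coeff_mul]
  simp only [PowerSeries.coeff_mk]

lemma natDegree_midStepPoly_mul_le (B : ℕ → R) {P : R[X]} {i j : ℕ} (hij : i ≤ j)
    (hP : P.natDegree ≤ i) : (midStepPoly K B (j - i) * P).natDegree ≤ j :=
  natDegree_mul_le.trans <|
    (add_le_add (natDegree_midStepPoly_le B _) hP).trans (Nat.sub_add_cancel hij).le

lemma natDegree_stepsPoly_le (B : ℕ → R) (j : ℕ) : (stepsPoly K B j).natDegree ≤ j := by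
  induction j using Nat.strong_induction_on with
  | _ j ih =>
    cases j with
    | zero => simp [stepsPoly]
    | succ j =>
      rw [stepsPoly]
      exact natDegree_antidiff_le <| natDegree_sum_le_of_forall_le _ _ fun i _ =>
        natDegree_midStepPoly_mul_le B (Nat.lt_succ_iff.1 i.2) (ih i i.2)

lemma coeff_stepsPoly (B : ℕ → R) (j : ℕ) : (stepsPoly K B j).coeff j = propagatorCoeff K B j := by
  induction j using Nat.strong_induction_on with
  | _ j ih =>
    cases j with
    | zero => simp [stepsPoly, propagatorCoeff]
    | succ j =>
      rw [stepsPoly, propagatorCoeff, coeff_antidiff, finsetSum_coeff]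
      · congr 1
        refine sum_congr rfl fun i _ => ?_
        have htop := coeff_mul_add_eq_of_natDegree_le (natDegree_midStepPoly_le (K := K) B (j - i))
          (natDegree_stepsPoly_le (K := K) B i)
        rw [Nat.sub_add_cancel (Nat.lt_succ_iff.1 i.2)] at htop
        rw [htop, coeff_midStepPoly, ih i i.2]
      · exact natDegree_sum_le_of_forall_le _ _ fun i _ =>
          natDegree_midStepPoly_mul_le B (Nat.lt_succ_iff.1 i.2) (natDegree_stepsPoly_le B i)

lemma coeff_zero_stepsPoly (B : ℕ → R) {j : ℕ} (hj : j ≠ 0) : (stepsPoly K B j).coeff 0 = 0 := by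
  obtain ⟨i, rfl⟩ := Nat.exists_eq_succ_of_ne_zero hj
  rw [stepsPoly, coeff_zero_antidiff]

/-- The expansion in the step size of `x` consecutive midpoint steps. The coefficients are
polynomials in `x`, which gives a meaning to a negative number of steps. -/
noncomputable def stepsSeries (B : ℕ → R) (x : K) : R⟦X⟧ :=
  PowerSeries.mk fun j => scalarEval x (stepsPoly K B j)

lemma coeff_stepsSeries (B : ℕ → R) (x : K) (j : ℕ) :
    PowerSeries.coeff j (stepsSeries B x) =
      ∑ n ∈ range (j + 1), x ^ n • (stepsPoly K B j).coeff n := by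
  rw [stepsSeries, PowerSeries.coeff_mk,
    scalarEval_eq_sum_range x (Nat.lt_succ_of_le (natDegree_stepsPoly_le B j))]

lemma stepsSeries_add_one (B : ℕ → R) (x : K) :
    stepsSeries B (x + 1) = midStepSeries B (x + 1 / 2) * stepsSeries B x := by
  ext j
  cases j with
  | zero =>
    rw [PowerSeries.coeff_mul, Nat.antidiagonal_zero, sum_singleton, coeff_zero_midStepSeries,
      one_mul]
    simp [stepsSeries, stepsPoly]
  | succ j =>
    rw [PowerSeries.coeff_mul, Nat.sum_antidiagonal_succ, coeff_zero_midStepSeries, one_mul]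
    simp only [stepsSeries, PowerSeries.coeff_mk, coeff_succ_midStepSeries]
    rw [stepsPoly, scalarEval_add_one_antidiff, map_sum, ← sum_fin_eq_sum_antidiagonal fun a b =>
      scalarEval x (midStepPoly K B a) * scalarEval x (stepsPoly K B b)]
    simp only [map_mul]

lemma stepsSeries_zero (B : ℕ → R) : stepsSeries B (0 : K) = 1 := by
  ext j
  rw [stepsSeries, PowerSeries.coeff_mk, scalarEval_zero, PowerSeries.coeff_one]
  rcases eq_or_ne j 0 with rfl | hj
  · simp [stepsPoly]
  · rw [coeff_zero_stepsPoly B hj, if_neg hj]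

lemma dilate_neg_one_stepsSeries_neg (B : ℕ → R) (N : ℕ) :
    dilate (-1 : K) (stepsSeries B (-N : K)) = stepsSeries B (N : K) := by
  induction N with
  | zero => simp [stepsSeries_zero]
  | succ N ih =>
    have hstep := stepsSeries_add_one B (-(N + 1 : ℕ) : K)
    have hstart : (-(N + 1 : ℕ) : K) + 1 = -N := by push_cast; ring
    have hmid : (-(N + 1 : ℕ) : K) + 1 / 2 = -(N + 1 / 2) := by push_cast; ring
    rw [hstart, hmid] at hstep
    rw [Nat.cast_succ, stepsSeries_add_one B (N : K), ← ih, hstep, map_mul, ← mul_assoc,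
      midStepSeries_mul_dilate_neg_one, one_mul, Nat.cast_succ]

/-- The midpoint rule is time symmetric, so its expansion contains only even powers of the
step size `1 / N` relative to the leading term. -/
lemma coeff_stepsSeries_natCast (B : ℕ → R) (N j : ℕ) :
    PowerSeries.coeff j (stepsSeries B (N : K)) =
      ∑ n ∈ range (j + 1) with Even (n + j), (N : K) ^ n • (stepsPoly K B j).coeff n := by
  have hreflect : PowerSeries.coeff j (stepsSeries B (N : K)) =
      ∑ n ∈ range (j + 1), ((-1) ^ (n + j) * (N : K) ^ n) • (stepsPoly K B j).coeff n := by
    rw [← dilate_neg_one_stepsSeries_neg, coeff_dilate, coeff_stepsSeries, smul_sum]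
    refine sum_congr rfl fun n _ => ?_
    rw [smul_smul, neg_pow (N : K), pow_add, ← mul_assoc, mul_comm ((-1) ^ j)]
  have htwo : (2 : K) • PowerSeries.coeff j (stepsSeries B (N : K)) = (2 : K) •
      ∑ n ∈ range (j + 1) with Even (n + j), (N : K) ^ n • (stepsPoly K B j).coeff n := by
    rw [two_smul]
    nth_rw 2 [hreflect]
    rw [coeff_stepsSeries, ← sum_add_distrib, smul_sum, sum_filter]
    refine sum_congr rfl fun n _ => ?_
    split_ifs with h
    · rw [h.neg_one_pow, one_mul, two_smul]
    · rw [(Nat.not_even_iff_odd.1 h).neg_one_pow, neg_one_mul, neg_smul, add_neg_cancel]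
  simpa [smul_smul] using congrArg ((2 : K)⁻¹ • ·) htwo

/-- The step-size expansion of the multiproduct formula with step numbers `k` and weights `a`. -/
noncomputable def multiproductSeries {ι : Type*} [Fintype ι] (k : ι → ℕ) (a : ι → K) (B : ℕ → R) :
    R⟦X⟧ :=
  ∑ i, a i • dilate (k i : K)⁻¹ (stepsSeries B (k i : K))

end FormalMidpoint

section Vandermonde

open Finset

variable {M : ℕ} {k : Fin M → ℕ} {a : Fin M → ℝ}

lemma SatisfiesVandermonde.sum_eq_one (h : SatisfiesVandermonde k a) (hM : 0 < M) :
    ∑ i, a i = 1 := by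
  simpa using h 0 hM

lemma SatisfiesVandermonde.one_le_sum_abs (h : SatisfiesVandermonde k a) (hM : 0 < M) :
    1 ≤ ∑ i, |a i| :=
  h.sum_eq_one hM ▸ sum_le_sum fun i _ => le_abs_self (a i)

lemma SatisfiesVandermonde.sum_mul_inv_pow_mul_pow (h : SatisfiesVandermonde k a)
    (hk : ∀ i, k i ≠ 0) {l : ℕ} (hl : l < M) (n : ℕ) :
    ∑ i, a i * ((k i : ℝ)⁻¹ ^ (n + 2 * l) * (k i : ℝ) ^ n) = if l = 0 then 1 else 0 := by
  rw [← h l hl]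
  refine sum_congr rfl fun i _ => ?_
  have hki : (k i : ℝ) ≠ 0 := Nat.cast_ne_zero.2 (hk i)
  rw [pow_add, mul_right_comm, ← mul_pow, inv_mul_cancel₀ hki, one_pow, one_mul, inv_pow]

variable {R : Type*} [Ring R] [Algebra ℝ R]

lemma SatisfiesVandermonde.coeff_multiproductSeries (h : SatisfiesVandermonde k a)
    (hk : ∀ i, k i ≠ 0) (hM : 0 < M) (B : ℕ → R) {j : ℕ} (hj : j ≤ 2 * M) :
    PowerSeries.coeff j (multiproductSeries k a B) = propagatorCoeff ℝ B j := by
  have hlower : ∀ n ∈ {n ∈ range (j + 1) | Even (n + j)}, n ≠ j →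
      (∑ i, a i * ((k i : ℝ)⁻¹ ^ j * (k i : ℝ) ^ n)) • (stepsPoly ℝ B j).coeff n = 0 := by
    intro n hn hnj
    obtain ⟨hn, q, hq⟩ := mem_filter.1 hn
    have hnj' : n < j := by have := mem_range.1 hn; omega
    rcases Nat.eq_zero_or_pos n with rfl | hn0
    · rw [coeff_zero_stepsPoly B (by omega), smul_zero]
    · obtain ⟨l, rfl⟩ : ∃ l, j = n + 2 * l := ⟨q - n, by omega⟩
      rw [h.sum_mul_inv_pow_mul_pow hk (by omega), if_neg (by omega), zero_smul]
  calc PowerSeries.coeff j (multiproductSeries k a B)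
      = ∑ n ∈ range (j + 1) with Even (n + j),
          (∑ i, a i * ((k i : ℝ)⁻¹ ^ j * (k i : ℝ) ^ n)) • (stepsPoly ℝ B j).coeff n := by
        simp only [multiproductSeries, map_sum, PowerSeries.coeff_smul, coeff_dilate,
          coeff_stepsSeries_natCast, smul_sum, sum_smul, smul_smul]
        exact sum_comm
    _ = (stepsPoly ℝ B j).coeff j := by
        rw [sum_eq_single_of_mem j (by simp) hlower]
        have htop := h.sum_mul_inv_pow_mul_pow hk hM j
        rw [mul_zero, add_zero, if_pos rfl] at htop
        rw [htop, one_smul]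
    _ = propagatorCoeff ℝ B j := coeff_stepsPoly B j

end Vandermonde

/-! ### Weighted norms and evaluation of power series -/

section WeightedNorm

open Finset PowerSeries
open scoped ENNReal

variable {R : Type*} [NormedRing R]

/-- The weighted `ℓ¹` norm `∑ ‖pₙ‖ ρ ^ n` of a power series. -/
noncomputable def weightedNorm (ρ : ℝ≥0∞) (p : R⟦X⟧) : ℝ≥0∞ :=
  ∑' n, ‖coeff n p‖ₑ * ρ ^ n

lemma weightedNorm_mono {ρ σ : ℝ≥0∞} (h : ρ ≤ σ) (p : R⟦X⟧) :
    weightedNorm ρ p ≤ weightedNorm σ p :=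
  ENNReal.tsum_le_tsum fun n => by gcongr

lemma weightedNorm_le_of_hasSum {ρ C : ℝ} (hρ : 0 ≤ ρ) {p : R⟦X⟧} {c : ℕ → ℝ}
    (h : ∀ n, ‖coeff n p‖ * ρ ^ n ≤ c n) (hc : HasSum c C) :
    weightedNorm (ENNReal.ofReal ρ) p ≤ ENNReal.ofReal C := by
  have hc0 : ∀ n, 0 ≤ c n := fun n => (by positivity : 0 ≤ ‖coeff n p‖ * ρ ^ n).trans (h n)
  rw [← hc.tsum_eq, ENNReal.ofReal_tsum_of_nonneg hc0 hc.summable]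
  refine ENNReal.tsum_le_tsum fun n => ?_
  rw [← ofReal_norm, ← ENNReal.ofReal_pow hρ, ← ENNReal.ofReal_mul (norm_nonneg _)]
  exact ENNReal.ofReal_le_ofReal (h n)

lemma weightedNorm_mul_le_pow_mul {c : ℝ≥0∞} (hc : c ≤ 1) (ρ : ℝ≥0∞) {p : R⟦X⟧} {n : ℕ}
    (h : ∀ j < n, coeff j p = 0) : weightedNorm (c * ρ) p ≤ c ^ n * weightedNorm ρ p := by
  rw [weightedNorm, weightedNorm, ← ENNReal.tsum_mul_left]
  refine ENNReal.tsum_le_tsum fun j => ?_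
  rcases lt_or_ge j n with hj | hj
  · simp [h j hj]
  · rw [mul_left_comm, mul_pow]
    gcongr _ * (?_ * _)
    exact pow_le_pow_right_of_le_one' hc hj

lemma tsum_mul_tsum_eq_tsum_sum_antidiagonal (f g : ℕ → ℝ≥0∞) :
    (∑' n, f n) * ∑' n, g n = ∑' n, ∑ ij ∈ antidiagonal n, f ij.1 * g ij.2 := by
  simp_rw [← ENNReal.tsum_mul_right, ← ENNReal.tsum_mul_left]
  rw [← ENNReal.tsum_prod, ← HasAntidiagonal.sigmaAntidiagonalEquivProd.tsum_eq,
    ENNReal.tsum_sigma']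
  refine tsum_congr fun n => ?_
  rw [tsum_fintype, ← sum_coe_sort (antidiagonal n) fun ij => f ij.1 * g ij.2]
  rfl

lemma weightedNorm_mul_le (ρ : ℝ≥0∞) (p q : R⟦X⟧) :
    weightedNorm ρ (p * q) ≤ weightedNorm ρ p * weightedNorm ρ q := by
  rw [weightedNorm, weightedNorm, weightedNorm, tsum_mul_tsum_eq_tsum_sum_antidiagonal]
  refine ENNReal.tsum_le_tsum fun n => ?_
  rw [coeff_mul]
  calc ‖∑ ij ∈ antidiagonal n, coeff ij.1 p * coeff ij.2 q‖ₑ * ρ ^ n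
      ≤ (∑ ij ∈ antidiagonal n, ‖coeff ij.1 p‖ₑ * ‖coeff ij.2 q‖ₑ) * ρ ^ n := by
        gcongr
        refine (enorm_sum_le _ _).trans (sum_le_sum fun ij _ => ?_)
        simp only [enorm_eq_nnnorm]
        exact_mod_cast nnnorm_mul_le (coeff ij.1 p) (coeff ij.2 q)
    _ = ∑ ij ∈ antidiagonal n, ‖coeff ij.1 p‖ₑ * ρ ^ ij.1 * (‖coeff ij.2 q‖ₑ * ρ ^ ij.2) := by
        rw [sum_mul]
        refine sum_congr rfl fun ij hij => ?_
        rw [← mem_antidiagonal.1 hij, pow_add]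
        ring

lemma weightedNorm_one [NormOneClass R] (ρ : ℝ≥0∞) : weightedNorm ρ (1 : R⟦X⟧) = 1 := by
  rw [weightedNorm, tsum_eq_single 0 fun n hn => by simp [coeff_one, hn]]
  simp

lemma weightedNorm_pow_le [NormOneClass R] (ρ : ℝ≥0∞) (p : R⟦X⟧) (n : ℕ) :
    weightedNorm ρ (p ^ n) ≤ weightedNorm ρ p ^ n := by
  induction n with
  | zero => simp [weightedNorm_one]
  | succ n ih =>
    rw [pow_succ, pow_succ]
    exact (weightedNorm_mul_le _ _ _).trans (by gcongr)

lemma weightedNorm_sub_le (ρ : ℝ≥0∞) (p q : R⟦X⟧) :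
    weightedNorm ρ (p - q) ≤ weightedNorm ρ p + weightedNorm ρ q := by
  rw [weightedNorm, weightedNorm, weightedNorm, ← ENNReal.tsum_add]
  refine ENNReal.tsum_le_tsum fun n => ?_
  rw [← add_mul, map_sub]
  gcongr
  exact enorm_sub_le

lemma weightedNorm_sum_le {ι : Type*} (s : Finset ι) (ρ : ℝ≥0∞) (p : ι → R⟦X⟧) :
    weightedNorm ρ (∑ i ∈ s, p i) ≤ ∑ i ∈ s, weightedNorm ρ (p i) := by
  simp only [weightedNorm]
  rw [← Summable.tsum_finsetSum fun _ _ => ENNReal.summable]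
  refine ENNReal.tsum_le_tsum fun n => ?_
  rw [← sum_mul, map_sum]
  gcongr
  exact enorm_sum_le _ _

lemma weightedNorm_X_mul (ρ : ℝ≥0∞) (p : R⟦X⟧) :
    weightedNorm ρ (X * p) = ρ * weightedNorm ρ p := by
  rw [weightedNorm, tsum_eq_zero_add' ENNReal.summable, coeff_zero_X_mul, enorm_zero, zero_mul,
    zero_add, weightedNorm, ← ENNReal.tsum_mul_left]
  refine tsum_congr fun n => ?_
  rw [coeff_succ_X_mul, pow_succ']
  ring

variable {𝕜 : Type*} [NormedField 𝕜] [NormedAlgebra 𝕜 R]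

lemma weightedNorm_smul (ρ : ℝ≥0∞) (c : 𝕜) (p : R⟦X⟧) :
    weightedNorm ρ (c • p) = ‖c‖ₑ * weightedNorm ρ p := by
  rw [weightedNorm, weightedNorm, ← ENNReal.tsum_mul_left]
  exact tsum_congr fun n => by rw [coeff_smul, enorm_smul, mul_assoc]

lemma weightedNorm_dilate (ρ : ℝ≥0∞) (c : 𝕜) (p : R⟦X⟧) :
    weightedNorm ρ (dilate c p) = weightedNorm (ρ * ‖c‖ₑ) p := by
  refine tsum_congr fun n => ?_
  rw [coeff_dilate, enorm_smul, enorm_pow, mul_pow]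
  ring

lemma tsum_weightedNorm_smul_pow_le [NormOneClass R] (ρ : ℝ≥0∞) (f : 𝕜⟦X⟧) (p : R⟦X⟧) :
    ∑' r, weightedNorm ρ (coeff r f • p ^ r) ≤ weightedNorm (weightedNorm ρ p) f :=
  ENNReal.tsum_le_tsum fun r => by
    rw [weightedNorm_smul]
    gcongr
    exact weightedNorm_pow_le ρ p r

lemma weightedNorm_substXMul_le [NormOneClass R] (ρ : ℝ≥0∞) (f : 𝕜⟦X⟧) (p : R⟦X⟧) :
    weightedNorm ρ (substXMul f p) ≤ weightedNorm (weightedNorm ρ (X * p)) f := by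
  refine le_trans ?_ (tsum_weightedNorm_smul_pow_le ρ f (X * p))
  simp only [weightedNorm]
  rw [ENNReal.tsum_comm]
  refine ENNReal.tsum_le_tsum fun j => ?_
  rw [ENNReal.tsum_mul_right, substXMul, coeff_mk]
  gcongr
  exact (enorm_sum_le _ _).trans (ENNReal.sum_le_tsum _)

lemma weightedNorm_ofReal_exp_le {𝕜 : Type*} [RCLike 𝕜] {c : ℝ} (hc : 0 ≤ c) :
    weightedNorm (ENNReal.ofReal c) (PowerSeries.exp 𝕜) ≤ ENNReal.ofReal (Real.exp c) := by
  rw [Real.exp_eq_exp_ℝ]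
  refine weightedNorm_le_of_hasSum hc (fun n => ?_) (NormedSpace.expSeries_div_hasSum_exp c)
  rw [PowerSeries.coeff_exp, one_div, map_inv₀, map_natCast, norm_inv, RCLike.norm_natCast,
    inv_mul_eq_div]

lemma weightedNorm_formalDeriv_mul_le (ρ d : ℝ≥0∞) (p : R⟦X⟧) :
    weightedNorm ρ (formalDeriv p) * d ≤ weightedNorm (ρ + d) p := by
  have hpow : ∀ n : ℕ, (n + 1) * ρ ^ n * d ≤ (ρ + d) ^ (n + 1) := by
    intro n
    induction n with
    | zero => simp
    | succ n ih =>
      calc ((n + 1 : ℕ) + 1) * ρ ^ (n + 1) * d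
          = (n + 1) * ρ ^ n * d * ρ + ρ ^ (n + 1) * d := by push_cast; ring
        _ ≤ (ρ + d) ^ (n + 1) * ρ + (ρ + d) ^ (n + 1) * d := by gcongr; exact le_self_add
        _ = (ρ + d) ^ (n + 1 + 1) := by ring
  rw [weightedNorm, weightedNorm, tsum_eq_zero_add' (f := fun n => ‖coeff n p‖ₑ * (ρ + d) ^ n)
    ENNReal.summable, ← ENNReal.tsum_mul_right]
  refine (ENNReal.tsum_le_tsum fun n => ?_).trans le_add_self
  calc ‖coeff n (formalDeriv p)‖ₑ * ρ ^ n * d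
      ≤ (n + 1) * ‖coeff (n + 1) p‖ₑ * ρ ^ n * d := by
        gcongr
        rw [formalDeriv, coeff_mk]
        simp only [enorm_eq_nnnorm]
        exact_mod_cast nnnorm_nsmul_le (a := coeff (n + 1) p) (n := n + 1)
    _ = ‖coeff (n + 1) p‖ₑ * ((n + 1) * ρ ^ n * d) := by ring
    _ ≤ ‖coeff (n + 1) p‖ₑ * (ρ + d) ^ (n + 1) := by gcongr; exact hpow n

lemma weightedNorm_formalDeriv_ne_top {ρ σ : ℝ≥0∞} (h : ρ < σ) {p : R⟦X⟧}
    (hp : weightedNorm σ p ≠ ⊤) : weightedNorm ρ (formalDeriv p) ≠ ⊤ := by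
  intro htop
  have hmul := weightedNorm_formalDeriv_mul_le ρ (σ - ρ) p
  rw [add_tsub_cancel_of_le h.le, htop, ENNReal.top_mul (tsub_pos_of_lt h).ne'] at hmul
  exact hp (top_le_iff.1 hmul)

end WeightedNorm

section SeriesEval

open Finset PowerSeries
open scoped ENNReal

variable {𝕜 R : Type*} [NormedField 𝕜] [NormedRing R] [NormedAlgebra 𝕜 R]

/-- The value `∑ s ^ n pₙ` of a power series over a Banach algebra at a scalar `s`. It is meaningful
only when the series converges, for instance when `weightedNorm ‖s‖ₑ p` is finite. -/
noncomputable def seriesEval (s : 𝕜) (p : R⟦X⟧) : R :=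
  ∑' n, s ^ n • coeff n p

lemma tsum_enorm_pow_smul_coeff (s : 𝕜) (p : R⟦X⟧) :
    ∑' n, ‖s ^ n • coeff n p‖ₑ = weightedNorm ‖s‖ₑ p :=
  tsum_congr fun n => by rw [enorm_smul, enorm_pow, mul_comm]

lemma summable_norm_pow_smul_coeff {s : 𝕜} {p : R⟦X⟧} (h : weightedNorm ‖s‖ₑ p ≠ ⊤) :
    Summable fun n => ‖s ^ n • coeff n p‖ := by
  rwa [← tsum_enorm_ne_top_iff_summable_norm, tsum_enorm_pow_smul_coeff]

lemma enorm_seriesEval_le (s : 𝕜) (p : R⟦X⟧) : ‖seriesEval s p‖ₑ ≤ weightedNorm ‖s‖ₑ p :=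
  enorm_tsum_le_tsum_enorm.trans (tsum_enorm_pow_smul_coeff s p).le

lemma seriesEval_dilate (s c : 𝕜) (p : R⟦X⟧) :
    seriesEval s (dilate c p) = seriesEval (s * c) p :=
  tsum_congr fun n => by rw [coeff_dilate, smul_smul, mul_pow]

lemma seriesEval_one (s : 𝕜) : seriesEval s (1 : R⟦X⟧) = 1 := by
  rw [seriesEval, tsum_eq_single 0 fun n hn => by simp [coeff_one, hn]]
  simp

lemma seriesEval_smul (s c : 𝕜) (p : R⟦X⟧) : seriesEval s (c • p) = c • seriesEval s p := by
  rw [seriesEval, seriesEval, ← tsum_const_smul'']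
  exact tsum_congr fun n => by rw [coeff_smul, smul_comm]

variable [CompleteSpace R]

lemma seriesEval_X_mul {s : 𝕜} {p : R⟦X⟧} (h : weightedNorm ‖s‖ₑ (X * p) ≠ ⊤) :
    seriesEval s (X * p) = s • seriesEval s p := by
  rw [seriesEval, (summable_norm_pow_smul_coeff h).of_norm.tsum_eq_zero_add, coeff_zero_X_mul,
    smul_zero, zero_add, seriesEval, ← tsum_const_smul'']
  exact tsum_congr fun n => by rw [coeff_succ_X_mul, smul_smul, pow_succ']

lemma seriesEval_sub {s : 𝕜} {p q : R⟦X⟧} (hp : weightedNorm ‖s‖ₑ p ≠ ⊤)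
    (hq : weightedNorm ‖s‖ₑ q ≠ ⊤) : seriesEval s (p - q) = seriesEval s p - seriesEval s q := by
  rw [seriesEval, seriesEval, seriesEval, ← (summable_norm_pow_smul_coeff hp).of_norm.tsum_sub
    (summable_norm_pow_smul_coeff hq).of_norm]
  exact tsum_congr fun n => by rw [map_sub, smul_sub]

lemma seriesEval_sum {ι : Type*} {s : 𝕜} (t : Finset ι) {p : ι → R⟦X⟧}
    (hp : ∀ i ∈ t, weightedNorm ‖s‖ₑ (p i) ≠ ⊤) :
    seriesEval s (∑ i ∈ t, p i) = ∑ i ∈ t, seriesEval s (p i) := by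
  simp only [seriesEval]
  rw [← Summable.tsum_finsetSum fun i hi => (summable_norm_pow_smul_coeff (hp i hi)).of_norm]
  exact tsum_congr fun n => by rw [map_sum, smul_sum]

lemma seriesEval_mul {s : 𝕜} {p q : R⟦X⟧} (hp : weightedNorm ‖s‖ₑ p ≠ ⊤)
    (hq : weightedNorm ‖s‖ₑ q ≠ ⊤) : seriesEval s (p * q) = seriesEval s p * seriesEval s q := by
  rw [seriesEval, seriesEval, seriesEval, tsum_mul_tsum_eq_tsum_sum_antidiagonal_of_summable_norm
    (summable_norm_pow_smul_coeff hp) (summable_norm_pow_smul_coeff hq)]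
  refine tsum_congr fun n => ?_
  rw [coeff_mul, smul_sum]
  refine sum_congr rfl fun ij hij => ?_
  rw [smul_mul_smul_comm, ← pow_add, mem_antidiagonal.1 hij]

variable [NormOneClass R]

lemma seriesEval_pow {s : 𝕜} {p : R⟦X⟧} (hp : weightedNorm ‖s‖ₑ p ≠ ⊤) (n : ℕ) :
    seriesEval s (p ^ n) = seriesEval s p ^ n := by
  induction n with
  | zero => simp [seriesEval_one]
  | succ n ih =>
    rw [pow_succ, pow_succ, seriesEval_mul _ hp, ih]
    exact ne_top_of_le_ne_top (ENNReal.pow_ne_top hp) (weightedNorm_pow_le _ _ _)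

lemma seriesEval_substXMul {s : 𝕜} {f : 𝕜⟦X⟧} {p : R⟦X⟧} (hp : weightedNorm ‖s‖ₑ (X * p) ≠ ⊤)
    (hf : weightedNorm (weightedNorm ‖s‖ₑ (X * p)) f ≠ ⊤) :
    seriesEval s (substXMul f p) = ∑' r, coeff r f • (s • seriesEval s p) ^ r := by
  have hsum : Summable fun rj : ℕ × ℕ => s ^ rj.2 • coeff rj.2 (coeff rj.1 f • (X * p) ^ rj.1) := by
    refine Summable.of_norm (tsum_enorm_ne_top_iff_summable_norm.1 ?_)
    refine ne_top_of_le_ne_top hf (le_trans ?_ (tsum_weightedNorm_smul_pow_le ‖s‖ₑ f (X * p)))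
    rw [ENNReal.tsum_prod']
    exact ENNReal.tsum_le_tsum fun r => (tsum_enorm_pow_smul_coeff s _).le
  have hcoeff : ∀ j, ∑' r, s ^ j • coeff j (coeff r f • (X * p) ^ r) =
      s ^ j • coeff j (substXMul f p) := by
    intro j
    rw [tsum_eq_sum (s := range (j + 1)), substXMul, coeff_mk, smul_sum]
    · simp only [coeff_smul]
    · intro r hr
      rw [coeff_smul, coeff_X_mul_pow, if_neg (by simpa using hr), smul_zero, smul_zero]
  calc seriesEval s (substXMul f p)
      = ∑' j, ∑' r, s ^ j • coeff j (coeff r f • (X * p) ^ r) := by simp only [hcoeff, seriesEval]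
    _ = ∑' r, seriesEval s (coeff r f • (X * p) ^ r) :=
        (hsum.tsum_comm (f := fun r j => s ^ j • coeff j (coeff r f • (X * p) ^ r)))
    _ = ∑' r, coeff r f • (s • seriesEval s p) ^ r := by
        simp only [seriesEval_smul, seriesEval_pow hp, seriesEval_X_mul hp]

end SeriesEval

section SeriesEvalRCLike

open PowerSeries

variable {𝕜 R : Type*} [RCLike 𝕜] [NormedRing R] [NormedAlgebra 𝕜 R] [CompleteSpace R]

lemma seriesEval_substXMul_exp [NormOneClass R] {s : 𝕜} {p : R⟦X⟧}
    (hp : weightedNorm ‖s‖ₑ (X * p) ≠ ⊤) :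
    seriesEval s (substXMul (PowerSeries.exp 𝕜) p) = NormedSpace.exp (s • seriesEval s p) := by
  have hexp : weightedNorm (weightedNorm ‖s‖ₑ (X * p)) (PowerSeries.exp 𝕜) ≠ ⊤ := by
    rw [← ENNReal.ofReal_toReal hp]
    exact ne_top_of_le_ne_top ENNReal.ofReal_ne_top
      (weightedNorm_ofReal_exp_le ENNReal.toReal_nonneg)
  rw [seriesEval_substXMul hp hexp, NormedSpace.exp_eq_tsum 𝕜]
  exact tsum_congr fun r => by simp [PowerSeries.coeff_exp]

lemma hasDerivAt_seriesEval {ρ : ENNReal} {p : R⟦X⟧} (hp : weightedNorm ρ p ≠ ⊤) {s : 𝕜}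
    (hs : ‖s‖ₑ < ρ) :
    HasDerivAt (fun x => seriesEval x p) (seriesEval s (formalDeriv p)) s := by
  obtain ⟨t, hst, htρ⟩ := ENNReal.lt_iff_exists_nnreal_btwn.1 hs
  have hst' : ‖s‖ < t := by exact_mod_cast hst
  have hderiv : weightedNorm ‖((t : ℝ) : 𝕜)‖ₑ (formalDeriv p) ≠ ⊤ := by
    rw [← ofReal_norm, RCLike.norm_of_nonneg t.coe_nonneg, ENNReal.ofReal_coe_nnreal]
    exact weightedNorm_formalDeriv_ne_top htρ hp
  have hbound : Summable fun n : ℕ => n * (t : ℝ) ^ (n - 1) * ‖coeff n p‖ := by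
    rw [← summable_nat_add_iff 1]
    refine (summable_norm_pow_smul_coeff hderiv).congr fun n => ?_
    rw [formalDeriv, coeff_mk, ← Nat.cast_smul_eq_nsmul 𝕜, norm_smul, norm_smul,
      RCLike.norm_natCast, norm_pow, RCLike.norm_of_nonneg t.coe_nonneg, Nat.add_sub_cancel]
    ring
  have hnorm : ∀ n : ℕ, ∀ x ∈ Metric.ball (0 : 𝕜) t,
      ‖((n : 𝕜) * x ^ (n - 1)) • coeff n p‖ ≤ n * (t : ℝ) ^ (n - 1) * ‖coeff n p‖ := by
    intro n x hx
    rw [norm_smul, norm_mul, norm_pow, RCLike.norm_natCast]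
    gcongr
    exact (mem_ball_zero_iff.1 hx).le
  have hs0 : s ∈ Metric.ball (0 : 𝕜) t := mem_ball_zero_iff.2 hst'
  have hmain := hasDerivAt_tsum_of_isPreconnected hbound Metric.isOpen_ball
    (convex_ball (0 : 𝕜) t).isPreconnected
    (fun n x _ => (hasDerivAt_pow n x).smul_const (coeff n p)) hnorm
    (Metric.mem_ball_self ((norm_nonneg s).trans_lt hst'))
    (summable_of_ne_finset_zero (s := {0}) fun n hn => by
      rw [zero_pow (by simpa using hn), zero_smul]) hs0
  refine hmain.congr_deriv ?_
  rw [(Summable.of_norm_bounded hbound fun n => hnorm n s hs0).tsum_eq_zero_add, Nat.cast_zero,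
    zero_mul, zero_smul, zero_add]
  refine tsum_congr fun n => ?_
  rw [formalDeriv, coeff_mk, ← Nat.cast_smul_eq_nsmul 𝕜, smul_smul, mul_comm, Nat.add_sub_cancel]

end SeriesEvalRCLike

/-! ### Convergence of the expansions -/

section Convergence

open Finset PowerSeries

variable {𝕜 R : Type*} [RCLike 𝕜] [NormedRing R] {B : ℕ → R} {Λ ρ : ℝ}

lemma weightedNorm_mk_le (hB : ∀ p, ‖B p‖ ≤ Λ ^ (p + 1) / p.factorial) (hρ : 0 ≤ ρ) :
    weightedNorm (ENNReal.ofReal ρ) (mk B) ≤ ENNReal.ofReal (Λ * Real.exp (Λ * ρ)) := by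
  rw [Real.exp_eq_exp_ℝ]
  refine weightedNorm_le_of_hasSum hρ (fun n => ?_)
    ((NormedSpace.expSeries_div_hasSum_exp (Λ * ρ)).mul_left Λ)
  calc ‖coeff n (mk B)‖ * ρ ^ n ≤ Λ ^ (n + 1) / n.factorial * ρ ^ n := by
        rw [coeff_mk]
        gcongr
        exact hB n
    _ = Λ * ((Λ * ρ) ^ n / n.factorial) := by ring

variable [NormedAlgebra 𝕜 R]

lemma weightedNorm_X_mul_dilate_mk_le (hB : ∀ p, ‖B p‖ ≤ Λ ^ (p + 1) / p.factorial) (hρ : 0 ≤ ρ)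
    (y : 𝕜) : weightedNorm (ENNReal.ofReal ρ) (X * dilate y (mk B)) ≤
      ENNReal.ofReal (ρ * (Λ * Real.exp (Λ * (ρ * ‖y‖)))) := by
  rw [weightedNorm_X_mul, weightedNorm_dilate, ← ofReal_norm, ← ENNReal.ofReal_mul hρ,
    ENNReal.ofReal_mul (q := Λ * _) hρ]
  exact mul_le_mul_right (weightedNorm_mk_le hB (by positivity)) _

variable [NormOneClass R]

lemma norm_propagatorCoeff_le (hB : ∀ p, ‖B p‖ ≤ Λ ^ (p + 1)) (j : ℕ) :
    ‖propagatorCoeff 𝕜 B j‖ ≤ Λ ^ j := by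
  induction j using Nat.strong_induction_on with
  | _ j ih =>
    cases j with
    | zero => simp [propagatorCoeff]
    | succ j =>
      have hterm : ∀ i : Fin (j + 1), ‖B (j - i) * propagatorCoeff 𝕜 B i‖ ≤ Λ ^ (j + 1) := by
        intro i
        calc ‖B (j - i) * propagatorCoeff 𝕜 B i‖
            ≤ Λ ^ (j - i + 1 : ℕ) * Λ ^ (i : ℕ) :=
              norm_mul_le_of_le (hB _) (ih i i.2)
          _ = Λ ^ (j + 1) := by rw [← pow_add]; congr 1; omega
      have hnorm : ‖((j : 𝕜) + 1)⁻¹‖ = ((j : ℝ) + 1)⁻¹ := by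
        rw [norm_inv, ← Nat.cast_succ, RCLike.norm_natCast, Nat.cast_succ]
      rw [propagatorCoeff, norm_smul, hnorm, inv_mul_le_iff₀ (by positivity)]
      refine (norm_sum_le_of_le _ fun i _ => hterm i).trans ?_
      simp

lemma weightedNorm_mk_propagatorCoeff_le (hB : ∀ p, ‖B p‖ ≤ Λ ^ (p + 1)) (hρ : 0 ≤ ρ)
    (hΛρ : Λ * ρ ≤ 1 / 2) :
    weightedNorm (ENNReal.ofReal ρ) (mk (propagatorCoeff 𝕜 B)) ≤ 2 := by
  have hΛ : 0 ≤ Λ := by simpa using (norm_nonneg _).trans (hB 0)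
  have hbound := weightedNorm_le_of_hasSum (p := mk (propagatorCoeff 𝕜 B)) hρ (fun n => ?_)
    hasSum_geometric_two
  · simpa using hbound
  · calc ‖coeff n (mk (propagatorCoeff 𝕜 B))‖ * ρ ^ n ≤ Λ ^ n * ρ ^ n := by
          rw [coeff_mk]
          gcongr
          exact norm_propagatorCoeff_le hB n
      _ = (Λ * ρ) ^ n := (mul_pow _ _ _).symm
      _ ≤ (1 / 2) ^ n := pow_le_pow_left₀ (mul_nonneg hΛ hρ) hΛρ n

lemma weightedNorm_midStepSeries_le (hB : ∀ p, ‖B p‖ ≤ Λ ^ (p + 1) / p.factorial) (hρ : 0 ≤ ρ)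
    {m : ℕ} (hm : 0 < m) (hΛρ : Λ * (m * ρ) ≤ 1 / 2) {y : 𝕜} (hy : ‖y‖ ≤ m) :
    weightedNorm (ENNReal.ofReal ρ) (midStepSeries B y) ≤ ENNReal.ofReal (Real.exp (1 / m)) := by
  have hΛ : 0 ≤ Λ := by simpa using (norm_nonneg _).trans (hB 0)
  have hexp : Real.exp (Λ * (ρ * ‖y‖)) ≤ 2 := by
    calc Real.exp (Λ * (ρ * ‖y‖)) ≤ Real.exp (1 / 2) := by
          refine Real.exp_le_exp.2 (le_trans ?_ hΛρ)
          rw [mul_comm ρ]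
          gcongr
      _ ≤ 1 / (1 - 1 / 2) := Real.exp_bound_div_one_sub_of_interval (by norm_num) (by norm_num)
      _ = 2 := by norm_num
  have hinner : ρ * (Λ * Real.exp (Λ * (ρ * ‖y‖))) ≤ 1 / m := by
    calc ρ * (Λ * Real.exp (Λ * (ρ * ‖y‖))) ≤ ρ * (Λ * 2) := by gcongr
      _ = 2 * (Λ * (m * ρ)) / m := by field_simp
      _ ≤ 2 * (1 / 2) / m := by gcongr
      _ = 1 / m := by norm_num
  refine (weightedNorm_substXMul_le _ _ _).trans ?_
  refine le_trans ?_ (weightedNorm_ofReal_exp_le (𝕜 := 𝕜) (by positivity))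
  exact weightedNorm_mono ((weightedNorm_X_mul_dilate_mk_le hB hρ y).trans
    (ENNReal.ofReal_le_ofReal hinner)) _

lemma norm_natCast_add_half_le {N m : ℕ} (h : N < m) : ‖(N : 𝕜) + 1 / 2‖ ≤ m := by
  have h' : (N : ℝ) + 1 ≤ m := by exact_mod_cast h
  refine (norm_add_le _ _).trans ?_
  rw [RCLike.norm_natCast, norm_div, norm_one, RCLike.norm_ofNat]
  linarith

lemma weightedNorm_stepsSeries_le_pow (hB : ∀ p, ‖B p‖ ≤ Λ ^ (p + 1) / p.factorial) (hρ : 0 ≤ ρ)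
    {m : ℕ} (hΛρ : Λ * (m * ρ) ≤ 1 / 2) {N : ℕ} (hN : N ≤ m) :
    weightedNorm (ENNReal.ofReal ρ) (stepsSeries B (N : 𝕜)) ≤
      ENNReal.ofReal (Real.exp (1 / m)) ^ N := by
  induction N with
  | zero => rw [Nat.cast_zero, stepsSeries_zero, weightedNorm_one, pow_zero]
  | succ N ih =>
    rw [Nat.cast_succ, stepsSeries_add_one, pow_succ']
    refine (weightedNorm_mul_le _ _ _).trans (mul_le_mul' ?_ (ih (by omega)))
    exact weightedNorm_midStepSeries_le hB hρ (by omega) hΛρ (norm_natCast_add_half_le hN)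

lemma weightedNorm_stepsSeries_le (hB : ∀ p, ‖B p‖ ≤ Λ ^ (p + 1) / p.factorial) (hρ : 0 ≤ ρ)
    {m : ℕ} (hm : 0 < m) (hΛρ : Λ * (m * ρ) ≤ 1 / 2) :
    weightedNorm (ENNReal.ofReal ρ) (stepsSeries B (m : 𝕜)) ≤ 3 := by
  refine (weightedNorm_stepsSeries_le_pow hB hρ hΛρ le_rfl).trans ?_
  rw [← ENNReal.ofReal_pow (Real.exp_nonneg _), ← Real.exp_nat_mul,
    mul_one_div_cancel (Nat.cast_ne_zero.2 hm.ne')]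
  exact ENNReal.ofReal_le_ofNat.2 Real.exp_one_lt_three.le

variable [CompleteSpace R]

lemma seriesEval_stepsSeries (hB : ∀ p, ‖B p‖ ≤ Λ ^ (p + 1) / p.factorial) {h : 𝕜} {m : ℕ}
    (hh : Λ * (m * ‖h‖) ≤ 1 / 2) {N : ℕ} (hN : N ≤ m) :
    seriesEval h (stepsSeries B (N : 𝕜)) = orderedProd (fun q : ℕ =>
      NormedSpace.exp (h • seriesEval (h * (q + 1 / 2)) (mk B))) N := by
  induction N with
  | zero => rw [Nat.cast_zero, stepsSeries_zero, seriesEval_one, orderedProd]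
  | succ N ih =>
    have hmid := weightedNorm_midStepSeries_le hB (norm_nonneg h) (by omega) hh
      (norm_natCast_add_half_le (𝕜 := 𝕜) hN)
    have hsteps := weightedNorm_stepsSeries_le_pow (𝕜 := 𝕜) hB (norm_nonneg h) hh
      (Nat.le_of_succ_le hN)
    have hexponent := weightedNorm_X_mul_dilate_mk_le hB (norm_nonneg h) ((N : 𝕜) + 1 / 2)
    rw [ofReal_norm] at hmid hsteps hexponent
    rw [Nat.cast_succ, stepsSeries_add_one,
      seriesEval_mul (ne_top_of_le_ne_top ENNReal.ofReal_ne_top hmid)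
        (ne_top_of_le_ne_top (ENNReal.pow_ne_top ENNReal.ofReal_ne_top) hsteps),
      ih (Nat.le_of_succ_le hN), orderedProd, midStepSeries,
      seriesEval_substXMul_exp (ne_top_of_le_ne_top ENNReal.ofReal_ne_top hexponent),
      seriesEval_dilate]

lemma hasDerivAt_seriesEval_mk_propagatorCoeff (hB : ∀ p, ‖B p‖ ≤ Λ ^ (p + 1) / p.factorial)
    (hΛ : 0 < Λ) {s : 𝕜} (hs : Λ * ‖s‖ < 1 / 2) :
    HasDerivAt (fun x => seriesEval x (mk (propagatorCoeff 𝕜 B)))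
      (seriesEval s (mk B) * seriesEval s (mk (propagatorCoeff 𝕜 B))) s := by
  have hB' : ∀ p, ‖B p‖ ≤ Λ ^ (p + 1) := fun p =>
    (hB p).trans (div_le_self (by positivity) (Nat.one_le_cast.2 p.factorial_pos))
  have hsρ : ‖s‖ < 1 / 2 / Λ := (lt_div_iff₀' hΛ).2 hs
  have hprop : ∀ {ρ : ℝ}, 0 ≤ ρ → Λ * ρ ≤ 1 / 2 →
      weightedNorm (ENNReal.ofReal ρ) (mk (propagatorCoeff 𝕜 B)) ≠ ⊤ := fun hρ hΛρ =>
    ne_top_of_le_ne_top ENNReal.ofNat_ne_top (weightedNorm_mk_propagatorCoeff_le hB' hρ hΛρ)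
  have hcoeff : weightedNorm ‖s‖ₑ (mk B) ≠ ⊤ := by
    rw [← ofReal_norm]
    exact ne_top_of_le_ne_top ENNReal.ofReal_ne_top (weightedNorm_mk_le hB (norm_nonneg s))
  have hprops : weightedNorm ‖s‖ₑ (mk (propagatorCoeff 𝕜 B)) ≠ ⊤ := by
    rw [← ofReal_norm]
    exact hprop (norm_nonneg s) hs.le
  rw [← seriesEval_mul hcoeff hprops, ← formalDeriv_mk_propagatorCoeff]
  refine hasDerivAt_seriesEval (hprop (by positivity) (mul_div_cancel₀ _ hΛ.ne').le) ?_
  rw [← ofReal_norm]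
  exact (ENNReal.ofReal_lt_ofReal_iff_of_nonneg (norm_nonneg s)).2 hsρ

end Convergence

section MultiproductSeries

open Finset PowerSeries

variable {𝕜 R : Type*} [RCLike 𝕜] [NormedRing R] [NormedAlgebra 𝕜 R] [NormOneClass R]
  {B : ℕ → R} {Λ : ℝ} {ι : Type*} [Fintype ι] {k : ι → ℕ} {a : ι → 𝕜}

lemma natCast_mul_norm_inv_natCast_mul {m : ℕ} (hm : m ≠ 0) (ρ : ℝ) :
    m * (‖(m : 𝕜)⁻¹‖ * ρ) = ρ := by
  rw [norm_inv, RCLike.norm_natCast, mul_inv_cancel_left₀ (Nat.cast_ne_zero.2 hm)]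

lemma weightedNorm_smul_dilate_stepsSeries_le (hB : ∀ p, ‖B p‖ ≤ Λ ^ (p + 1) / p.factorial) {ρ : ℝ}
    (hρ : 0 ≤ ρ) (hΛρ : Λ * ρ ≤ 1 / 2) {m : ℕ} (hm : m ≠ 0) (c : 𝕜) :
    weightedNorm (ENNReal.ofReal ρ) (c • dilate (m : 𝕜)⁻¹ (stepsSeries B (m : 𝕜))) ≤
      ‖c‖ₑ * 3 := by
  rw [weightedNorm_smul, weightedNorm_dilate, mul_comm (ENNReal.ofReal ρ), ← ofReal_norm (_⁻¹),
    ← ENNReal.ofReal_mul (norm_nonneg _)]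
  gcongr
  refine weightedNorm_stepsSeries_le hB (by positivity) (Nat.pos_of_ne_zero hm) ?_
  rwa [natCast_mul_norm_inv_natCast_mul hm]

lemma weightedNorm_multiproductSeries_le (hB : ∀ p, ‖B p‖ ≤ Λ ^ (p + 1) / p.factorial) {ρ : ℝ}
    (hρ : 0 ≤ ρ) (hΛρ : Λ * ρ ≤ 1 / 2) (hk : ∀ i, k i ≠ 0) :
    weightedNorm (ENNReal.ofReal ρ) (multiproductSeries k a B) ≤
      ENNReal.ofReal (3 * ∑ i, ‖a i‖) := by
  refine (weightedNorm_sum_le _ _ _).trans ?_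
  rw [mul_comm, sum_mul, ENNReal.ofReal_sum_of_nonneg fun i _ => by positivity]
  refine sum_le_sum fun i _ => ?_
  rw [ENNReal.ofReal_mul (norm_nonneg _), ofReal_norm, ENNReal.ofReal_ofNat]
  exact weightedNorm_smul_dilate_stepsSeries_le hB hρ hΛρ (hk i) (a i)

variable [CompleteSpace R]

lemma seriesEval_multiproductSeries (hB : ∀ p, ‖B p‖ ≤ Λ ^ (p + 1) / p.factorial)
    (hk : ∀ i, k i ≠ 0) {s : 𝕜} (hs : Λ * ‖s‖ ≤ 1 / 2) :
    seriesEval s (multiproductSeries k a B) = ∑ i, a i • orderedProd (fun q : ℕ =>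
      NormedSpace.exp ((s / k i) • seriesEval (s / k i * (q + 1 / 2)) (mk B))) (k i) := by
  have hterm : ∀ i, weightedNorm ‖s‖ₑ (a i • dilate (k i : 𝕜)⁻¹ (stepsSeries B (k i : 𝕜))) ≠ ⊤ := by
    intro i
    have hle := weightedNorm_smul_dilate_stepsSeries_le hB (norm_nonneg s) hs (hk i) (a i)
    rw [ofReal_norm] at hle
    exact ne_top_of_le_ne_top (ENNReal.mul_ne_top enorm_ne_top ENNReal.ofNat_ne_top) hle
  rw [multiproductSeries, seriesEval_sum _ fun i _ => hterm i]
  refine sum_congr rfl fun i _ => ?_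
  have hsi : Λ * (k i * ‖s / k i‖) ≤ 1 / 2 := by
    rwa [div_eq_inv_mul, norm_mul, natCast_mul_norm_inv_natCast_mul (hk i)]
  rw [seriesEval_smul, seriesEval_dilate, ← div_eq_mul_inv, seriesEval_stepsSeries hB hsi le_rfl]

end MultiproductSeries

section VanishingOrder

open PowerSeries

lemma norm_seriesEval_le_of_coeff_eq_zero {𝕜 R : Type*} [NormedField 𝕜] [NormedRing R]
    [NormedAlgebra 𝕜 R] {p : R⟦X⟧} {ρ C : ℝ} (hρ : 0 < ρ) (hC : 0 ≤ C)
    (hp : weightedNorm (ENNReal.ofReal ρ) p ≤ ENNReal.ofReal C) {n : ℕ}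
    (h : ∀ j < n, coeff j p = 0) {s : 𝕜} (hs : ‖s‖ ≤ ρ) :
    ‖seriesEval s p‖ ≤ (‖s‖ / ρ) ^ n * C := by
  have hscale : ‖s‖ₑ = ENNReal.ofReal (‖s‖ / ρ) * ENNReal.ofReal ρ := by
    rw [← ENNReal.ofReal_mul (by positivity), div_mul_cancel₀ _ hρ.ne', ofReal_norm]
  rw [← ENNReal.ofReal_le_ofReal_iff (by positivity), ofReal_norm]
  calc ‖seriesEval s p‖ₑ ≤ weightedNorm ‖s‖ₑ p := enorm_seriesEval_le s p
    _ ≤ ENNReal.ofReal (‖s‖ / ρ) ^ n * weightedNorm (ENNReal.ofReal ρ) p := by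
        rw [hscale]
        exact weightedNorm_mul_le_pow_mul
          (ENNReal.ofReal_le_one.2 (div_le_one_of_le₀ hs hρ.le)) _ h
    _ ≤ ENNReal.ofReal ((‖s‖ / ρ) ^ n * C) := by
        rw [ENNReal.ofReal_mul (by positivity), ENNReal.ofReal_pow (by positivity)]
        gcongr

variable {R : Type*} [NormedRing R] [NormedAlgebra ℝ R] [NormOneClass R] [CompleteSpace R]

lemma SatisfiesVandermonde.norm_seriesEval_sub_le {M : ℕ} {k : Fin M → ℕ} {a : Fin M → ℝ}
    (h : SatisfiesVandermonde k a) (hk : ∀ i, k i ≠ 0) (hM : 0 < M) {B : ℕ → R} {Λ : ℝ}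
    (hΛ : 0 < Λ) (hB : ∀ p, ‖B p‖ ≤ Λ ^ (p + 1) / p.factorial) {s : ℝ} (hs : Λ * ‖s‖ ≤ 1 / 2) :
    ‖seriesEval s (mk (propagatorCoeff ℝ B)) - seriesEval s (multiproductSeries k a B)‖ ≤
      (2 * Λ * ‖s‖) ^ (2 * M + 1) * (2 + 3 * ∑ i, |a i|) := by
  have hB' : ∀ p, ‖B p‖ ≤ Λ ^ (p + 1) := fun p =>
    (hB p).trans (div_le_self (by positivity) (Nat.one_le_cast.2 p.factorial_pos))
  have hwprop : ∀ {ρ : ℝ}, 0 ≤ ρ → Λ * ρ ≤ 1 / 2 →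
      weightedNorm (ENNReal.ofReal ρ) (mk (propagatorCoeff ℝ B)) ≤ 2 := fun hρ hΛρ =>
    weightedNorm_mk_propagatorCoeff_le hB' hρ hΛρ
  have hwmult : ∀ {ρ : ℝ}, 0 ≤ ρ → Λ * ρ ≤ 1 / 2 →
      weightedNorm (ENNReal.ofReal ρ) (multiproductSeries k a B) ≤
        ENNReal.ofReal (3 * ∑ i, |a i|) := fun hρ hΛρ =>
    weightedNorm_multiproductSeries_le hB hρ hΛρ hk
  have hρ : 0 < 1 / 2 / Λ := by positivity
  have hΛρ : Λ * (1 / 2 / Λ) ≤ 1 / 2 := (mul_div_cancel₀ _ hΛ.ne').le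
  have hsub := seriesEval_sub
    (ne_top_of_le_ne_top ENNReal.ofNat_ne_top (ofReal_norm s ▸ hwprop (norm_nonneg s) hs))
    (ne_top_of_le_ne_top ENNReal.ofReal_ne_top (ofReal_norm s ▸ hwmult (norm_nonneg s) hs))
  have hscale : ‖s‖ / (1 / 2 / Λ) = 2 * Λ * ‖s‖ := by field_simp
  rw [← hsub, ← hscale]
  refine norm_seriesEval_le_of_coeff_eq_zero hρ (by positivity) ?_ (fun j hj => ?_)
    ((le_div_iff₀' hΛ).2 hs)
  · rw [ENNReal.ofReal_add zero_le_two (by positivity), ENNReal.ofReal_ofNat]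
    exact (weightedNorm_sub_le _ _ _).trans (add_le_add (hwprop hρ.le hΛρ) (hwmult hρ.le hΛρ))
  · rw [map_sub, coeff_mk, h.coeff_multiproductSeries hk hM B (Nat.lt_succ_iff.1 hj), sub_self]

end VanishingOrder

/-! ### Hermitian Hamiltonians -/

section Taylor

open Set

lemma hasSum_taylor_of_norm_iteratedDerivWithin_le {E : Type*} [NormedAddCommGroup E]
    [NormedSpace ℝ E] {f : ℝ → E} {a b x C Λ : ℝ} (hf : ContDiffOn ℝ ∞ f (Icc a b))
    (hC : ∀ j, ∀ t ∈ Icc a b, ‖iteratedDerivWithin j f (Icc a b) t‖ ≤ C * Λ ^ j)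
    (hx : x ∈ Icc a b) :
    HasSum (fun n => (x - a) ^ n • taylorCoeffWithin f n (Icc a b) a) (f x) := by
  have hab : a ≤ b := hx.1.trans hx.2
  have hxa : 0 ≤ x - a := sub_nonneg.2 hx.1
  have hsum : Summable fun n => ‖(x - a) ^ n • taylorCoeffWithin f n (Icc a b) a‖ := by
    refine Summable.of_nonneg_of_le (fun n => norm_nonneg _) (fun n => ?_)
      ((Real.summable_pow_div_factorial (Λ * (x - a))).mul_left C)
    rw [taylorCoeffWithin, norm_smul, norm_smul, norm_inv, Real.norm_natCast, norm_pow,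
      Real.norm_of_nonneg hxa]
    calc (x - a) ^ n * ((n.factorial : ℝ)⁻¹ * ‖iteratedDerivWithin n f (Icc a b) a‖)
        ≤ (x - a) ^ n * ((n.factorial : ℝ)⁻¹ * (C * Λ ^ n)) := by
          gcongr
          exact hC n a (left_mem_Icc.2 hab)
      _ = C * ((Λ * (x - a)) ^ n / n.factorial) := by rw [mul_pow]; ring
  have hremainder :
      Tendsto (fun n => ‖taylorWithinEval f n (Icc a b) a x - f x‖) atTop (nhds 0) := by
    have hlim := (FloorSemiring.tendsto_pow_div_factorial_atTop (Λ * (x - a))).const_mul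
      (C * (Λ * (x - a)))
    rw [mul_zero] at hlim
    refine squeeze_zero (fun _ => norm_nonneg _) (fun n => ?_) hlim
    rw [norm_sub_rev]
    refine (taylor_mean_remainder_bound hab (hf.of_le (by exact_mod_cast le_top)) hx
      (hC (n + 1))).trans_eq ?_
    rw [mul_pow]
    ring
  rw [hasSum_iff_tendsto_nat_of_summable_norm hsum, ← tendsto_add_atTop_iff_nat 1]
  refine (tendsto_iff_norm_sub_tendsto_zero.2 hremainder).congr fun n => ?_
  rw [taylor_within_apply]
  refine Finset.sum_congr rfl fun p _ => ?_
  rw [taylorCoeffWithin, smul_smul, mul_comm]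

end Taylor

section Unitary

open Set

lemma star_mul_eq_of_hasDerivWithinAt {𝔸 : Type*} [NormedRing 𝔸] [NormedAlgebra ℝ 𝔸] [StarRing 𝔸]
    [ContinuousStar 𝔸] [StarModule ℝ 𝔸] {A X Y : ℝ → 𝔸} {a b : ℝ}
    (hA : ∀ t ∈ Icc a b, A t ∈ skewAdjoint 𝔸)
    (hX : ∀ t ∈ Icc a b, HasDerivWithinAt X (A t * X t) (Icc a b) t)
    (hY : ∀ t ∈ Icc a b, HasDerivWithinAt Y (A t * Y t) (Icc a b) t) {t : ℝ} (ht : t ∈ Icc a b) :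
    star (X t) * Y t = star (X a) * Y a := by
  have hderiv : ∀ s ∈ Icc a b,
      HasDerivWithinAt (fun s => star (X s) * Y s) 0 (Icc a b) s := by
    intro s hs
    refine ((hX s hs).star.mul (hY s hs)).congr_deriv ?_
    rw [star_mul, skewAdjoint.mem_iff.1 (hA s hs)]
    noncomm_ring
  exact constant_of_has_deriv_right_zero (fun s hs => (hderiv s hs).continuousWithinAt)
    (fun s hs => (hderiv s (Ico_subset_Icc_self hs)).mono_of_mem_nhdsWithin
      (Icc_mem_nhdsGE_of_mem hs)) t ht

lemma orderedProd_mem {A S : Type*} [Monoid A] [SetLike S A] [SubmonoidClass S A] {s : S}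
    {f : ℕ → A} {n : ℕ} (h : ∀ q < n, f q ∈ s) : orderedProd f n ∈ s := by
  induction n with
  | zero => exact one_mem s
  | succ n ih => exact mul_mem (h n n.lt_succ_self) (ih fun q hq => h q (hq.trans n.lt_succ_self))

lemma orderedProd_congr {A : Type*} [Monoid A] {f g : ℕ → A} {n : ℕ} (h : ∀ q < n, f q = g q) :
    orderedProd f n = orderedProd g n := by
  induction n with
  | zero => rfl
  | succ n ih =>
    rw [orderedProd, orderedProd, h n n.lt_succ_self, ih fun q hq => h q (hq.trans n.lt_succ_self)]

lemma neg_I_smul_mem_skewAdjoint {A : Type*} [AddCommGroup A] [StarAddMonoid A] [Module ℂ A]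
    [StarModule ℂ A] {x : A} (hx : IsSelfAdjoint x) : -Complex.I • x ∈ skewAdjoint A :=
  hx.smul_mem_skewAdjoint (by simp [skewAdjoint.mem_iff])

variable {ι : Type*} [Fintype ι] [DecidableEq ι] {H U V : ℝ → Matrix ι ι ℂ} {t₀ t₁ Δt : ℝ}

lemma IsPropagator.hasDerivWithinAt (hU : IsPropagator H t₀ t₁ U) {t : ℝ} (ht : t ∈ Icc t₀ t₁) :
    HasDerivWithinAt U (-Complex.I • H t * U t) (Icc t₀ t₁) t := by
  rw [smul_mul_assoc]
  exact hU.2 t ht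

lemma IsPropagator.star_mul_eq_one (hH : ∀ t ∈ Icc t₀ t₁, (H t).IsHermitian)
    (hU : IsPropagator H t₀ t₁ U) (hV : IsPropagator H t₀ t₁ V) {t : ℝ} (ht : t ∈ Icc t₀ t₁) :
    star (U t) * V t = 1 := by
  rw [star_mul_eq_of_hasDerivWithinAt (fun s hs => neg_I_smul_mem_skewAdjoint (hH s hs))
    (fun _ => hU.hasDerivWithinAt) (fun _ => hV.hasDerivWithinAt) ht, hU.1, hV.1, star_one, one_mul]

lemma IsPropagator.mem_unitaryGroup (hH : ∀ t ∈ Icc t₀ t₁, (H t).IsHermitian)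
    (hU : IsPropagator H t₀ t₁ U) {t : ℝ} (ht : t ∈ Icc t₀ t₁) : U t ∈ Matrix.unitaryGroup ι ℂ :=
  Matrix.mem_unitaryGroup_iff'.2 (hU.star_mul_eq_one hH hU ht)

lemma IsPropagator.eqOn (hH : ∀ t ∈ Icc t₀ t₁, (H t).IsHermitian) (hU : IsPropagator H t₀ t₁ U)
    (hV : IsPropagator H t₀ t₁ V) : EqOn U V (Icc t₀ t₁) := fun t ht =>
  calc U t = U t * (star (U t) * V t) := by rw [hU.star_mul_eq_one hH hV ht, mul_one]
    _ = V t := by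
        rw [← mul_assoc, Unitary.mul_star_self_of_mem (hU.mem_unitaryGroup hH ht), one_mul]

lemma midpointSteps_eq (H : ℝ → Matrix ι ι ℂ) (k : ℕ) (t₀ Δt : ℝ) :
    midpointSteps H k t₀ Δt = orderedProd (fun q : ℕ =>
      NormedSpace.exp ((Δt / k) • (-Complex.I • H (t₀ + Δt / k * (q + 1 / 2))))) k := by
  refine orderedProd_congr fun q _ => ?_
  have hstep : (t₀ + Δt * ((q : ℝ) + 1) / k) - (t₀ + Δt * (q : ℝ) / k) = Δt / k := by ring
  have hmid : t₀ + Δt * (q : ℝ) / k + Δt / k / 2 = t₀ + Δt / k * (q + 1 / 2) := by ring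
  rw [midpointFormula, hstep, hmid, mul_comm, mul_smul, Complex.coe_smul]

lemma midpoint_mem_Icc (t₀ : ℝ) (hΔ : 0 ≤ Δt) {k q : ℕ} (hq : q < k) :
    t₀ + Δt / k * (q + 1 / 2) ∈ Icc t₀ (t₀ + Δt) := by
  have hk : (0 : ℝ) < k := Nat.cast_pos.2 (q.zero_le.trans_lt hq)
  have hq' : (q : ℝ) + 1 ≤ k := by exact_mod_cast hq
  refine ⟨le_add_of_nonneg_right (by positivity), add_le_add_right ?_ t₀⟩
  rw [div_mul_eq_mul_div, div_le_iff₀ hk]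
  gcongr
  linarith

lemma midpointSteps_mem_unitaryGroup (hH : ∀ t ∈ Icc t₀ (t₀ + Δt), (H t).IsHermitian)
    (hΔ : 0 ≤ Δt) (k : ℕ) : midpointSteps H k t₀ Δt ∈ Matrix.unitaryGroup ι ℂ := by
  let _ : NormedAlgebra ℚ (Matrix ι ι ℂ) := NormedAlgebra.restrictScalars ℚ ℂ _
  rw [midpointSteps_eq]
  exact orderedProd_mem fun q hq => NormedSpace.exp_mem_unitary_of_mem_skewAdjoint
    (skewAdjoint.smul_mem _ (neg_I_smul_mem_skewAdjoint (hH _ (midpoint_mem_Icc t₀ hΔ hq))))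

variable [Nonempty ι]

lemma norm_multiproductFormula_le (hH : ∀ t ∈ Icc t₀ (t₀ + Δt), (H t).IsHermitian) (hΔ : 0 ≤ Δt)
    {M : ℕ} (k : Fin M → ℕ) (a : Fin M → ℝ) :
    ‖multiproductFormula H k a t₀ Δt‖ ≤ ∑ i, |a i| := by
  refine norm_sum_le_of_le _ fun i _ => ?_
  rw [norm_smul, Complex.norm_real, Real.norm_eq_abs,
    CStarRing.norm_of_mem_unitary (midpointSteps_mem_unitaryGroup hH hΔ (k i)), mul_one]

lemma IsPropagator.norm_sub_multiproductFormula_le_one_add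
    (hH : ∀ t ∈ Icc t₀ (t₀ + Δt), (H t).IsHermitian) (hU : IsPropagator H t₀ (t₀ + Δt) U)
    (hΔ : 0 ≤ Δt) {M : ℕ} (k : Fin M → ℕ) (a : Fin M → ℝ) :
    ‖U (t₀ + Δt) - multiproductFormula H k a t₀ Δt‖ ≤ 1 + ∑ i, |a i| := by
  have hUnorm : ‖U (t₀ + Δt)‖ = 1 := CStarRing.norm_of_mem_unitary
    (hU.mem_unitaryGroup hH (right_mem_Icc.2 (le_add_of_nonneg_right hΔ)))
  exact norm_sub_le_of_le hUnorm.le (norm_multiproductFormula_le hH hΔ k a)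

end Unitary

section ErrorBound

open Set PowerSeries

variable {ι : Type*} [Fintype ι] [DecidableEq ι] {H U : ℝ → Matrix ι ι ℂ} {t₀ t₁ Δt Λ : ℝ}

lemma IsLambdaBound.norm_iteratedDerivWithin_le {I : Set ℝ} (hΛ : IsLambdaBound H I fun _ => Λ)
    {t : ℝ} (ht : t ∈ I) (j : ℕ) : ‖iteratedDerivWithin j H I t‖ ≤ Λ ^ (j + 1) := by
  have hpow := pow_le_pow_left₀ (Real.rpow_nonneg (norm_nonneg _) _) (hΛ t ht j) (j + 1)
  rwa [← Real.rpow_mul_natCast (norm_nonneg _), Nat.cast_succ, one_div_mul_cancel (by positivity),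
    Real.rpow_one] at hpow

/-- The Taylor coefficients at `t₀` of the generator `-iH`, with derivatives taken within `I`. -/
noncomputable def generatorCoeff (H : ℝ → Matrix ι ι ℂ) (I : Set ℝ) (t₀ : ℝ) (p : ℕ) :
    Matrix ι ι ℂ :=
  -Complex.I • taylorCoeffWithin H p I t₀

lemma IsLambdaBound.norm_generatorCoeff_le {I : Set ℝ} (hΛ : IsLambdaBound H I fun _ => Λ)
    (ht : t₀ ∈ I) (p : ℕ) : ‖generatorCoeff H I t₀ p‖ ≤ Λ ^ (p + 1) / p.factorial := by
  rw [generatorCoeff, taylorCoeffWithin, norm_smul, norm_smul, norm_neg, Complex.norm_I, one_mul,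
    norm_inv, Real.norm_natCast, inv_mul_eq_div]
  gcongr
  exact hΛ.norm_iteratedDerivWithin_le ht p

lemma seriesEval_mk_generatorCoeff (hH : ContDiffOn ℝ ∞ H (Icc t₀ t₁))
    (hΛ : IsLambdaBound H (Icc t₀ t₁) fun _ => Λ) {t : ℝ} (ht : t ∈ Icc t₀ t₁) :
    seriesEval (t - t₀) (mk (generatorCoeff H (Icc t₀ t₁) t₀)) = -Complex.I • H t := by
  have htaylor := hasSum_taylor_of_norm_iteratedDerivWithin_le (C := Λ) hH
    (fun j s hs => pow_succ' Λ j ▸ hΛ.norm_iteratedDerivWithin_le hs j) ht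
  refine ((htaylor.const_smul (-Complex.I)).congr_fun fun n => ?_).tsum_eq
  rw [coeff_mk, generatorCoeff, smul_comm]

variable [Nonempty ι]

lemma isPropagator_seriesEval (hH : ContDiffOn ℝ ∞ H (Icc t₀ t₁))
    (hΛ : IsLambdaBound H (Icc t₀ t₁) fun _ => Λ) (hΛ0 : 0 < Λ) (hsmall : Λ * (t₁ - t₀) < 1 / 2) :
    IsPropagator H t₀ t₁ fun t =>
      seriesEval (t - t₀) (mk (propagatorCoeff ℝ (generatorCoeff H (Icc t₀ t₁) t₀))) := by
  refine ⟨?_, fun t ht => ?_⟩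
  · change seriesEval (t₀ - t₀) _ = 1
    rw [sub_self, seriesEval, tsum_eq_single 0 fun n hn => by rw [zero_pow hn, zero_smul]]
    simp [propagatorCoeff]
  · have hB := hΛ.norm_generatorCoeff_le (left_mem_Icc.2 (ht.1.trans ht.2))
    have ht' : Λ * ‖t - t₀‖ < 1 / 2 := by
      rw [Real.norm_of_nonneg (sub_nonneg.2 ht.1)]
      exact (mul_le_mul_of_nonneg_left (sub_le_sub_right ht.2 t₀) hΛ0.le).trans_lt hsmall
    have hderiv := (hasDerivAt_seriesEval_mk_propagatorCoeff hB hΛ0 ht').comp_sub_const t t₀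
    rw [seriesEval_mk_generatorCoeff hH hΛ ht, smul_mul_assoc] at hderiv
    exact hderiv.hasDerivWithinAt

lemma multiproductFormula_eq_seriesEval (hH : ContDiffOn ℝ ∞ H (Icc t₀ (t₀ + Δt)))
    (hΛ : IsLambdaBound H (Icc t₀ (t₀ + Δt)) fun _ => Λ) (hΔ : 0 ≤ Δt) (hsmall : Λ * Δt ≤ 1 / 2)
    {M : ℕ} {k : Fin M → ℕ} (hk : ∀ i, k i ≠ 0) (a : Fin M → ℝ) :
    multiproductFormula H k a t₀ Δt =
      seriesEval Δt (multiproductSeries k a (generatorCoeff H (Icc t₀ (t₀ + Δt)) t₀)) := by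
  have hB := hΛ.norm_generatorCoeff_le (left_mem_Icc.2 (le_add_of_nonneg_right hΔ))
  rw [seriesEval_multiproductSeries hB hk (by rwa [Real.norm_of_nonneg hΔ])]
  refine Finset.sum_congr rfl fun i _ => ?_
  rw [Complex.coe_smul, midpointSteps_eq]
  congr 1
  refine orderedProd_congr fun q hq => ?_
  rw [← seriesEval_mk_generatorCoeff hH hΛ (midpoint_mem_Icc t₀ hΔ hq), add_sub_cancel_left]

variable {M : ℕ} {k : Fin M → ℕ} {a : Fin M → ℝ}

lemma IsPropagator.norm_sub_multiproductFormula_le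
    (hherm : ∀ t ∈ Icc t₀ (t₀ + Δt), (H t).IsHermitian) (hU : IsPropagator H t₀ (t₀ + Δt) U)
    (hH : ContDiffOn ℝ ∞ H (Icc t₀ (t₀ + Δt)))
    (hΛ : IsLambdaBound H (Icc t₀ (t₀ + Δt)) fun _ => Λ) (hΛ0 : 0 < Λ) (hΔ : 0 ≤ Δt)
    (hsmall : Λ * Δt < 1 / 2) (hk : ∀ i, k i ≠ 0) (h : SatisfiesVandermonde k a) (hM : 0 < M) :
    ‖U (t₀ + Δt) - multiproductFormula H k a t₀ Δt‖ ≤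
      (2 * Λ * Δt) ^ (2 * M + 1) * (2 + 3 * ∑ i, |a i|) := by
  have hend : t₀ ≤ t₀ + Δt := le_add_of_nonneg_right hΔ
  have hB := hΛ.norm_generatorCoeff_le (left_mem_Icc.2 hend)
  have hseries := isPropagator_seriesEval hH hΛ hΛ0 (by rwa [add_sub_cancel_left])
  have hbound := h.norm_seriesEval_sub_le hk hM hΛ0 hB (s := Δt)
    (by rw [Real.norm_of_nonneg hΔ]; exact hsmall.le)
  rw [Real.norm_of_nonneg hΔ] at hbound
  have hUend : U (t₀ + Δt) = seriesEval (t₀ + Δt - t₀) _ :=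
    hU.eqOn hherm hseries (right_mem_Icc.2 hend)
  rw [add_sub_cancel_left] at hUend
  rwa [hUend, multiproductFormula_eq_seriesEval hH hΛ hΔ hsmall.le hk]

lemma IsPropagator.norm_sub_multiproductFormula_lt
    (hherm : ∀ t ∈ Icc t₀ (t₀ + Δt), (H t).IsHermitian) (hU : IsPropagator H t₀ (t₀ + Δt) U)
    (hH : ContDiffOn ℝ ∞ H (Icc t₀ (t₀ + Δt)))
    (hΛ : IsLambdaBound H (Icc t₀ (t₀ + Δt)) fun _ => Λ) (hΛ0 : 0 < Λ) (hΔ : 0 < Δt)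
    (hk : ∀ i, k i ≠ 0) (h : SatisfiesVandermonde k a) (hM : 0 < M) :
    ‖U (t₀ + Δt) - multiproductFormula H k a t₀ Δt‖ <
      0.32 * (∑ i, |a i|) * (41 * Λ * Δt) ^ (2 * M + 1) := by
  have ha := h.one_le_sum_abs hM
  have hconst : 5 * ∑ i, |a i| < 0.32 * (∑ i, |a i|) * (41 / 2) ^ (2 * M + 1) := by
    calc 5 * ∑ i, |a i| < 0.32 * (∑ i, |a i|) * (41 / 2) ^ 3 := by norm_num; linarith
      _ ≤ 0.32 * (∑ i, |a i|) * (41 / 2) ^ (2 * M + 1) := by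
          gcongr
          · norm_num
          · omega
  rcases lt_or_ge (Λ * Δt) (1 / 2) with hsmall | hlarge
  · calc ‖U (t₀ + Δt) - multiproductFormula H k a t₀ Δt‖
        ≤ (2 * Λ * Δt) ^ (2 * M + 1) * (2 + 3 * ∑ i, |a i|) :=
          hU.norm_sub_multiproductFormula_le hherm hH hΛ hΛ0 hΔ.le hsmall hk h hM
      _ ≤ (2 * Λ * Δt) ^ (2 * M + 1) * (5 * ∑ i, |a i|) := by gcongr; linarith
      _ < (2 * Λ * Δt) ^ (2 * M + 1) * (0.32 * (∑ i, |a i|) * (41 / 2) ^ (2 * M + 1)) := by gcongr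
      _ = 0.32 * (∑ i, |a i|) * (41 * Λ * Δt) ^ (2 * M + 1) := by
          rw [mul_left_comm, ← mul_pow]
          ring
  · calc ‖U (t₀ + Δt) - multiproductFormula H k a t₀ Δt‖
        ≤ 1 + ∑ i, |a i| := hU.norm_sub_multiproductFormula_le_one_add hherm hΔ.le k a
      _ ≤ 5 * ∑ i, |a i| := by linarith
      _ < 0.32 * (∑ i, |a i|) * (41 / 2) ^ (2 * M + 1) := hconst
      _ ≤ 0.32 * (∑ i, |a i|) * (41 * Λ * Δt) ^ (2 * M + 1) := by
          gcongr
          linarith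

end ErrorBound

theorem mainTheorem1_general :
    ∃ (k : (M : ℕ) → Fin M → ℕ) (a : (M : ℕ) → Fin M → ℝ),
      ((fun M : ℕ => ∑ j, |a M j|) =O[atTop] fun M : ℕ => Real.log (M : ℝ)) ∧
      ((fun M : ℕ => ((Finset.univ.sup (k M) : ℕ) : ℝ)) =O[atTop] fun M : ℕ => (M : ℝ) ^ 2) ∧
      ∀ M : ℕ, 1 ≤ M →
        (∀ j, 0 < k M j) ∧ SatisfiesVandermonde (k M) (a M) ∧
        ∀ (ι : Type*) [Fintype ι] [DecidableEq ι] [Nonempty ι] (t₀ Δt : ℝ), 0 < Δt →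
        ∀ H : ℝ → Matrix ι ι ℂ,
          (∀ t ∈ Set.Icc t₀ (t₀ + Δt), (H t).IsHermitian) →
          ContDiffOn ℝ ∞ H (Set.Icc t₀ (t₀ + Δt)) →
        ∀ Λ : ℝ,
          IsLambdaBound H (Set.Icc t₀ (t₀ + Δt)) (fun _ => Λ) → 0 < Λ →
        ∀ U : ℝ → Matrix ι ι ℂ,
          IsPropagator H t₀ (t₀ + Δt) U →
          ‖U (t₀ + Δt) - multiproductFormula H (k M) (a M) t₀ Δt‖ <
            0.32 * (∑ j, |a M j|) * (41 * Λ * Δt) ^ (2 * M + 1) :=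
  ⟨stepNumber, stepWeight, sum_abs_stepWeight_isBigO, sup_stepNumber_isBigO, fun M hM =>
    ⟨stepNumber_pos M, satisfiesVandermonde_stepWeight M,
      fun _ι _ _ _ _t₀ _Δt hΔ _H hherm hH _Λ hΛ hΛ0 _U hU =>
        hU.norm_sub_multiproductFormula_lt hherm hH hΛ hΛ0 hΔ
          (fun j => (stepNumber_pos M j).ne') (satisfiesVandermonde_stepWeight M) hM⟩⟩

theorem mainTheorem1 :
    ∃ (k : (M : ℕ) → Fin M → ℕ) (a : (M : ℕ) → Fin M → ℝ),
      ((fun M : ℕ => ∑ j, |a M j|) =O[atTop] fun M : ℕ => Real.log (M : ℝ)) ∧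
      ((fun M : ℕ => ((Finset.univ.sup (k M) : ℕ) : ℝ)) =O[atTop] fun M : ℕ => (M : ℝ) ^ 2) ∧
      ∀ M : ℕ, 1 ≤ M →
        (∀ j, 0 < k M j) ∧ SatisfiesVandermonde (k M) (a M) ∧
        ∀ (n : ℕ) (t₀ Δt : ℝ), 0 < Δt →
        ∀ H : ℝ → Matrix (Fin (2 ^ n)) (Fin (2 ^ n)) ℂ,
          (∀ t ∈ Set.Icc t₀ (t₀ + Δt), (H t).IsHermitian) →
          ContDiffOn ℝ ∞ H (Set.Icc t₀ (t₀ + Δt)) →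
        ∀ (Λ : ℝ → ℝ) (Λmax : ℝ),
          IsLambdaBound H (Set.Icc t₀ (t₀ + Δt)) Λ →
          IsGreatest (Λ '' Set.Icc t₀ (t₀ + Δt)) Λmax → 0 < Λmax →
        ∀ U : ℝ → Matrix (Fin (2 ^ n)) (Fin (2 ^ n)) ℂ,
          IsPropagator H t₀ (t₀ + Δt) U →
          ‖U (t₀ + Δt) - multiproductFormula H (k M) (a M) t₀ Δt‖ <
            0.32 * (∑ j, |a M j|) * (41 * Λmax * Δt) ^ (2 * M + 1) := by
  obtain ⟨k, a, ha, hk, h⟩ := mainTheorem1_general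
  refine ⟨k, a, ha, hk, fun M hM => ⟨(h M hM).1, (h M hM).2.1, ?_⟩⟩
  intro n t₀ Δt hΔ H hherm hH Λ Λmax hΛ hmax hpos U hU
  exact (h M hM).2.2 _ t₀ Δt hΔ H hherm hH Λmax
    (fun t ht j => (hΛ t ht j).trans (hmax.2 (Set.mem_image_of_mem Λ ht))) hpos U hU
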